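/- Let $\mathbb{G}$ be an infinitary finitely generated group, where infinitary means that for all $\alpha,\beta,\gamma\in\mathbb{G}$ with $\alpha\beta\gamma\neq\beta$ the set $\{\alpha^n\beta\gamma^n \mid n\in\mathbb{N}\}$ is infinite. A weighted automaton over $\mathbb{G}$ with finite alphabet $A$ is a tuple $W=(Q,t_{init},t_{final},T)$ with a finite set of states $Q$ and finite relations $t_{init},t_{final}\subseteq Q\times\mathbb{G}$ and $T\subseteq Q\times A\times\mathbb{G}\times Q$. Write $p\xrightarrow{w\mid\alpha}q$ if there is a run from $p$ to $q$ on the word $w$ whose transitions have the product $\alpha$ (the empty run has output $1$). The automaton computes the relation $[\![W]\!]=\{(w,\alpha\beta\gamma)\mid (p,\alpha)\in t_{init},\ p\xrightarrow{w\mid\beta}q,\ (q,\gamma)\in t_{final}\}\subseteq A^*\times\mathbb{G}$, and two automata are equivalent if they compute the same relation. It is sequential if $|t_{init}|=1$ and for all $p\in Q$, $a\in A$ there is at most one transition of the form $(p,a,\alpha,q)$ in $T$. The union of finitely many automata is taken on the disjoint union of their states. Put $\mathrm{delay}(\alpha,\beta)=\alpha^{-1}\beta$. For an integer $k\ge 0$,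 $W$ satisfies the branching twinning property $\mathrm{BTP}_k$ if for all states $q_{i,j}$ ($0\le i,j\le k$), all $\gamma_j$ with $(q_{0,j},\gamma_j)\in t_{init}$, and all words $u_{i,j},v_{i,j}$ and weights $\alpha_{i,j},\beta_{i,j}$ with $q_{i-1,j}\xrightarrow{u_{i,j}\mid\alpha_{i,j}}q_{i,j}$ and $q_{i,j}\xrightarrow{v_{i,j}\mid\beta_{i,j}}q_{i,j}$ ($1\le i\le k$, $0\le j\le k$), there are $j\neq j'$ such that for every $i\in\{1,\dots,k\}$: if $u_{i',j}=u_{i',j'}$ and $v_{i',j}=v_{i',j'}$ for all $1\le i'\le i$, then $$\mathrm{delay}(\gamma_j\alpha_{1,j}\cdots\alpha_{i,j},\ \gamma_{j'}\alpha_{1,j'}\cdots\alpha_{i,j'})=\mathrm{delay}(\gamma_j\alpha_{1,j}\cdots\alpha_{i,j}\beta_{i,j},\ \gamma_{j'}\alpha_{1,j'}\cdots\alpha_{i,j'}\beta_{i,j'}).$$ Proposition. If a weighted automaton $W$ over $\mathbb{G}$ satisfies $\mathrm{BTP}_k$, then there are $k$ sequential weighted automata over $\mathbb{G}$ whose union is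 equivalent to $W$. Moreover, these automata can be built effectively: if the elements of $\mathbb{G}$ are coded by natural numbers in such a way that the set of codes is primitive recursive, each code denotes a single element, each element has a single code, and the product is computable, then there is a partial computable function that, given the size of an alphabet, an integer $k\ge 0$ and a finite description of a weighted automaton $W$ over $\mathbb{G}$ and this alphabet, halts whenever $W$ satisfies $\mathrm{BTP}_k$ and then outputs descriptions of $k$ sequential weighted automata whose union is equivalent to $W$. -/

import Mathlib

universe u v w

/-- A weighted automaton with alphabet `A`, set of states `Q` and weights in `M`.  The alphabet and
the set of states are required to be finite where automata are quantified over. -/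
structure WeightedAutomaton (A : Type u) (Q : Type v) (M : Type w) where
  /-- The initial relation. -/
  init : Set (Q × M)
  /-- The final relation. -/
  final : Set (Q × M)
  /-- The transitions `(p, a, α, q)`: from `p` to `q`, reading `a`, with weight `α`. -/
  trans : Set (Q × A × M × Q)
  init_finite : init.Finite
  final_finite : final.Finite
  trans_finite : trans.Finite

namespace WeightedAutomaton

variable {A : Type u} {Q : Type v} {M : Type w}

/-- `W.Run p x α q`: there is a run of `W` from `p` to `q` on the word `x` with output `α`. -/
inductive Run [Monoid M] (W : WeightedAutomaton A Q M) : Q → List A → M → Q → Prop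
  | nil (q : Q) : Run W q [] 1 q
  | cons {p q r : Q} {a : A} {x : List A} {α β : M} :
      (p, a, α, q) ∈ W.trans → Run W q x β r → Run W p (a :: x) (α * β) r

/-- The relation between words and weights computed by a weighted automaton. -/
def rel [Monoid M] (W : WeightedAutomaton A Q M) : Set (List A × M) :=
  {y | ∃ (p q : Q) (α β γ : M),
    (p, α) ∈ W.init ∧ W.Run p y.1 β q ∧ (q, γ) ∈ W.final ∧ y.2 = α * β * γ}

/-- A weighted automaton is sequential if it has exactly one initial pair and, for every state `p`
and letter `a`, at most one transition leaving `p` and reading `a`. -/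
def IsSequential (W : WeightedAutomaton A Q M) : Prop :=
  (∃! x, x ∈ W.init) ∧
    ∀ (p : Q) (a : A) (α β : M) (q r : Q),
      (p, a, α, q) ∈ W.trans → (p, a, β, r) ∈ W.trans → α = β ∧ q = r

/-- The union of a finite family of weighted automata, on the disjoint union of the states. -/
def union {ι : Type*} [Finite ι] {S : ι → Type v} (V : ∀ i, WeightedAutomaton A (S i) M) :
    WeightedAutomaton A (Σ i, S i) M where
  init := ⋃ i, (fun x : S i × M => ((⟨i, x.1⟩ : Σ i, S i), x.2)) '' (V i).init
  final := ⋃ i, (fun x : S i × M => ((⟨i, x.1⟩ : Σ i, S i), x.2)) '' (V i).final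
  trans := ⋃ i, (fun t : S i × A × M × S i =>
    ((⟨i, t.1⟩ : Σ i, S i), t.2.1, t.2.2.1, (⟨i, t.2.2.2⟩ : Σ i, S i))) '' (V i).trans
  init_finite := Set.finite_iUnion fun i => (V i).init_finite.image _
  final_finite := Set.finite_iUnion fun i => (V i).final_finite.image _
  trans_finite := Set.finite_iUnion fun i => (V i).trans_finite.image _

end WeightedAutomaton

/-- The delay between two elements of a group. -/
def delay {G : Type u} [Group G] (α β : G) : G := α⁻¹ * β

/-- Infinitary groups. -/
def IsInfinitary (G : Type u) [Group G] : Prop :=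
  ∀ α β γ : G, α * β * γ ≠ β → {x : G | ∃ n : ℕ, x = α ^ n * β * γ ^ n}.Infinite

/-- The branching twinning property of order `k`.  The indices `1, …, k` of the words, loops and
weights are represented by `Fin k`, hence shifted by one: `u i j` leads from the state `q i j`
to the state `q (i + 1) j`, on which there is the loop `v i j`.
`Fin.partialProd (fun l => α l j) i.succ` is the product of `α l j` for `l = 0, …, i`, in this
order. -/
def WeightedAutomaton.BTP {A : Type u} {Q : Type v} {G : Type w} [Group G]
    (W : WeightedAutomaton A Q G) (k : ℕ) : Prop :=
  ∀ (q : Fin (k + 1) → Fin (k + 1) → Q) (γ : Fin (k + 1) → G)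
    (u v : Fin k → Fin (k + 1) → List A) (α β : Fin k → Fin (k + 1) → G),
    (∀ j, (q 0 j, γ j) ∈ W.init) →
    (∀ i j, W.Run (q i.castSucc j) (u i j) (α i j) (q i.succ j)) →
    (∀ i j, W.Run (q i.succ j) (v i j) (β i j) (q i.succ j)) →
    ∃ j j' : Fin (k + 1), j ≠ j' ∧
      ∀ i : Fin k, (∀ i' ≤ i, u i' j = u i' j' ∧ v i' j = v i' j') →
        delay (γ j * Fin.partialProd (fun l => α l j) i.succ)
            (γ j' * Fin.partialProd (fun l => α l j') i.succ) =
          delay (γ j * Fin.partialProd (fun l => α l j) i.succ * β i j)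
            (γ j' * Fin.partialProd (fun l => α l j') i.succ * β i j')

/-- Finite descriptions of weighted automata, as inputs and outputs of algorithms: the number of
states, followed by the lists of the initial pairs, of the final pairs and of the transitions.
States and letters are given by their numbers. -/
abbrev WACode (M : Type u) : Type u :=
  ℕ × List (ℕ × M) × List (ℕ × M) × List (ℕ × ℕ × M × ℕ)

/-- The weighted automaton over the alphabet `Fin m` that is described by a code.  Entries in which
the number of a state or of a letter is out of range are ignored. -/
def WACode.toWA {M : Type u} (m : ℕ) (c : WACode M) : WeightedAutomaton (Fin m) (Fin c.1) M where
  init := {x | ((x.1 : ℕ), x.2) ∈ c.2.1}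
  final := {x | ((x.1 : ℕ), x.2) ∈ c.2.2.1}
  trans := {t | ((t.1 : ℕ), (t.2.1 : ℕ), t.2.2.1, (t.2.2.2 : ℕ)) ∈ c.2.2.2}
  init_finite := by
    refine Set.Finite.preimage (f := fun x : Fin c.1 × M => ((x.1 : ℕ), x.2)) ?_
      (List.finite_toSet c.2.1)
    rintro ⟨a, b⟩ - ⟨a', b'⟩ - h
    simpa [Fin.ext_iff] using h
  final_finite := by
    refine Set.Finite.preimage (f := fun x : Fin c.1 × M => ((x.1 : ℕ), x.2)) ?_
      (List.finite_toSet c.2.2.1)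
    rintro ⟨a, b⟩ - ⟨a', b'⟩ - h
    simpa [Fin.ext_iff] using h
  trans_finite := by
    refine Set.Finite.preimage (f := fun t : Fin c.1 × Fin m × M × Fin c.1 =>
      ((t.1 : ℕ), (t.2.1 : ℕ), t.2.2.1, (t.2.2.2 : ℕ))) ?_ (List.finite_toSet c.2.2.2)
    rintro ⟨a, b, d, e⟩ - ⟨a', b', d', e'⟩ - h
    simpa [Fin.ext_iff] using h

/-!
The left multiplier of a loop with weight `β` at a configuration with output `g` is `g * β * g⁻¹`.
Two simultaneous loops preserve the delay if and only if their left multipliers agree, which is an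
equivalence relation on runs.  Hence a violation of the branching twinning property of order `k` is
a family of `k + 1` runs that are divided step by step by the multipliers of loops.
`WeightedAutomaton.Branch` describes such families as binary trees; a tree with `n` leaves needs at
most `n - 1` levels, so the property excludes trees with `k + 1` leaves (`BTP.not_branch`).

Consider finitely many simultaneous runs.  If no loop common to all of them changes the delay of two
of them, then this delay is determined by the tuple of states along the runs, so it can be computed
along a path without loops, and there are only finitely many possible values.  Thus runs with large
mutual delays are told apart by common loops in the past, and separated families that start from
sets of configurations with large mutual delays can be merged (`branch_sum_of_far`).  It follows that
the set of configurations reached by a word either has all its delays in a fixed finite set, or splits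
into two nonempty parts between which the bound `k` can be distributed (`exists_split_of_far`): if all
annuli around a configuration were occupied, there would be `k + 1` configurations with large mutual
delays.

By induction on `k`, all sets of configurations can be distributed, up to left multiplication and
with finitely many cases, among `k` deterministic runs (`exists_isDistribution`).  The cases are the
states of the sequential automata, which share their states and transitions and differ only in the
initial pair.

The equivalence of these automata with the given one is witnessed by a finite set of pairs of sets of
configurations of both sides that is compatible with final outputs and with reading a letter
(`WeightedAutomaton.Linked`, `Linked.union_rel_eq`).  Whether a given finite object is such a witness
can be decided with finitely many products in the group (`WACode.computablePred_certifies`), so the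
algorithm searches for automata together with a witness; the search succeeds whenever the branching
twinning property holds (`WACode.exists_certificate`).
-/

namespace WeightedAutomaton

variable {A : Type u} {Q : Type v} {G : Type w} [Group G] {W : WeightedAutomaton A Q G}

/-! ### Configurations -/

/-- `W.Path x y z`: reading the word `y`, the automaton can pass from the configuration `x` to the
configuration `z`.  A configuration is a state together with the output produced so far. -/
def Path (W : WeightedAutomaton A Q G) (x : Q × G) (y : List A) (z : Q × G) : Prop :=
  W.Run x.1 y (x.2⁻¹ * z.2) z.1

theorem path_nil {x z : Q × G} : W.Path x [] z ↔ x = z := by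
  constructor
  · intro h
    generalize hα : x.2⁻¹ * z.2 = α at *
    obtain ⟨p, g⟩ := x
    obtain ⟨q, h'⟩ := z
    unfold Path at h
    rw [hα] at h
    simp only at h hα
    cases h
    rw [inv_mul_eq_one] at hα
    rw [hα]
  · rintro rfl
    unfold Path
    rw [inv_mul_cancel]
    exact Run.nil _

theorem Path.refl (x : Q × G) : W.Path x [] x := path_nil.2 rfl

theorem path_cons {x z : Q × G} {a : A} {y : List A} :
    W.Path x (a :: y) z ↔
      ∃ t : Q × G, (x.1, a, x.2⁻¹ * t.2, t.1) ∈ W.trans ∧ W.Path t y z := by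
  constructor
  · intro h
    generalize hα : x.2⁻¹ * z.2 = α at *
    unfold Path at h
    rw [hα] at h
    cases h with
    | cons h1 h2 =>
      rename_i q β γ
      refine ⟨(q, x.2 * β), by simpa using h1, ?_⟩
      have : (x.2 * β)⁻¹ * z.2 = γ := by
        rw [mul_inv_rev, mul_assoc, hα, inv_mul_cancel_left]
      unfold Path
      rwa [this]
  · rintro ⟨t, h1, h2⟩
    have := Run.cons h1 h2
    unfold Path
    convert this using 1
    group

theorem Path.append {x t z : Q × G} {y y' : List A} (h : W.Path x y t) (h' : W.Path t y' z) :
    W.Path x (y ++ y') z := by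
  induction y generalizing x with
  | nil => rw [path_nil] at h; subst h; exact h'
  | cons a y ih =>
    obtain ⟨s, h1, h2⟩ := path_cons.1 h
    exact path_cons.2 ⟨s, h1, ih h2⟩

/-- The configurations reached from `R` by reading the letter `a`. -/
def step (W : WeightedAutomaton A Q G) (R : Set (Q × G)) (a : A) : Set (Q × G) :=
  {z | ∃ x ∈ R, (x.1, a, x.2⁻¹ * z.2, z.1) ∈ W.trans}

/-- The configurations reached from `R` by reading the word `y`. -/
def reach (W : WeightedAutomaton A Q G) (R : Set (Q × G)) (y : List A) : Set (Q × G) :=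
  y.foldl W.step R

theorem mem_reach {R : Set (Q × G)} {y : List A} {z : Q × G} :
    z ∈ W.reach R y ↔ ∃ x ∈ R, W.Path x y z := by
  induction y generalizing R with
  | nil => simp [reach, path_nil]
  | cons a y ih =>
    change z ∈ W.reach (W.step R a) y ↔ _
    rw [ih]
    simp only [path_cons]
    constructor
    · rintro ⟨t, ⟨x, hx, h1⟩, h2⟩
      exact ⟨x, hx, t, h1, h2⟩
    · rintro ⟨x, hx, t, h1, h2⟩
      exact ⟨t, ⟨x, hx, h1⟩, h2⟩

theorem reach_concat (R : Set (Q × G)) (y : List A) (a : A) :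
    W.reach R (y ++ [a]) = W.step (W.reach R y) a := by
  simp [reach]

theorem reach_append (R : Set (Q × G)) (y y' : List A) :
    W.reach R (y ++ y') = W.reach (W.reach R y) y' := by
  simp [reach]

theorem reach_mono {R R' : Set (Q × G)} (h : R ⊆ R') (y : List A) :
    W.reach R y ⊆ W.reach R' y := by
  intro z hz
  obtain ⟨x, hx, hp⟩ := mem_reach.1 hz
  exact mem_reach.2 ⟨x, h hx, hp⟩

theorem exists_finset_subset_reach {R : Set (Q × G)} {y : List A} (Z : Finset (Q × G))
    (hZ : (Z : Set (Q × G)) ⊆ W.reach R y) :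
    ∃ Z' : Finset (Q × G), (Z' : Set (Q × G)) ⊆ R ∧ Z'.card ≤ Z.card ∧
      (Z : Set (Q × G)) ⊆ W.reach Z' y := by
  classical
  have h : ∀ z : Z, ∃ x ∈ R, W.Path x y z := fun z => mem_reach.1 (hZ z.2)
  choose f hf hp using h
  refine ⟨Z.attach.image f, ?_, ?_, ?_⟩
  · intro x hx
    simp only [Finset.coe_image, Set.mem_image, Finset.mem_coe, Finset.mem_attach, true_and] at hx
    obtain ⟨z, rfl⟩ := hx
    exact hf z
  · simpa using Finset.card_image_le (s := Z.attach) (f := f)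
  · intro z hz
    refine mem_reach.2 ⟨f ⟨z, hz⟩, ?_, hp ⟨z, hz⟩⟩
    simp only [Finset.coe_image]
    exact ⟨⟨z, hz⟩, by simp, rfl⟩

/-! ### Separated families of runs -/

/-- The configurations of `R` that carry a loop on `y` by which the output is multiplied from the
left by an element of `X`.  Two loops on `y` preserve the delay of their configurations if and only
if these left multipliers agree. -/
def loops (W : WeightedAutomaton A Q G) (R : Set (Q × G)) (y : List A) (X : Set G) :
    Set (Q × G) :=
  {x | x ∈ R ∧ ∃ h, W.Path x y (x.1, h) ∧ h * x.2⁻¹ ∈ X}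

theorem loops_mono {R R' : Set (Q × G)} (h : R ⊆ R') (y : List A) (X : Set G) :
    W.loops R y X ⊆ W.loops R' y X :=
  fun _ hx => ⟨h hx.1, hx.2⟩

/-- `W.Branch R n`: there are `n` runs from configurations in `R` any two of which are told apart by
loops, in the form of a binary tree.  At each inner node of the tree all runs read the same word,
reach configurations that carry loops on a common word, and are divided according to the left
multipliers of these loops. -/
inductive Branch (W : WeightedAutomaton A Q G) : Set (Q × G) → ℕ → Prop
  | zero (R : Set (Q × G)) : Branch W R 0
  | one {R : Set (Q × G)} : R.Nonempty → Branch W R 1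
  | split {R : Set (Q × G)} {y z : List A} {X : Set G} {m n : ℕ} :
      Branch W (W.loops (W.reach R y) z X) m → Branch W (W.loops (W.reach R y) z Xᶜ) n →
        Branch W R (m + n)

theorem Branch.mono {R R' : Set (Q × G)} {n : ℕ} (h : W.Branch R n) (hR : R ⊆ R') :
    W.Branch R' n := by
  induction h generalizing R' with
  | zero => exact .zero _
  | one h => exact .one (h.mono hR)
  | split _ _ ih1 ih2 =>
    exact .split (ih1 (loops_mono (reach_mono hR _) _ _)) (ih2 (loops_mono (reach_mono hR _) _ _))

theorem Branch.of_reach {R : Set (Q × G)} {y : List A} {n : ℕ} (h : W.Branch (W.reach R y) n) :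
    W.Branch R n := by
  generalize hR : W.reach R y = R' at h
  induction h generalizing R with
  | zero => exact .zero _
  | one h =>
    subst hR
    obtain ⟨z, hz⟩ := h
    obtain ⟨x, hx, -⟩ := mem_reach.1 hz
    exact .one ⟨x, hx⟩
  | split h1 h2 ih1 ih2 =>
    subst hR
    rw [← reach_append] at h1 h2
    exact .split h1 h2

theorem Branch.of_le {R : Set (Q × G)} {m n : ℕ} (h : W.Branch R n) (hm : m ≤ n) :
    W.Branch R m := by
  induction h generalizing m with
  | zero => obtain rfl : m = 0 := by omega
            exact .zero _
  | one h =>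
    obtain rfl | rfl : m = 0 ∨ m = 1 := by omega
    · exact .zero _
    · exact .one h
  | @split R y z X m1 n1 h1 h2 ih1 ih2 =>
    obtain ⟨a, b, ha, hb, rfl⟩ : ∃ a b, a ≤ m1 ∧ b ≤ n1 ∧ m = a + b :=
      ⟨min m m1, m - min m m1, by omega, by omega, by omega⟩
    exact .split (ih1 ha) (ih2 hb)

/-- The largest number of separated runs is subadditive in the set of starting configurations. -/
theorem Branch.exists_add {R R₁ R₂ : Set (Q × G)} {n : ℕ} (h : W.Branch R n)
    (hR : R ⊆ R₁ ∪ R₂) : ∃ n₁ n₂, n = n₁ + n₂ ∧ W.Branch R₁ n₁ ∧ W.Branch R₂ n₂ := by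
  induction h generalizing R₁ R₂ with
  | zero => exact ⟨0, 0, rfl, .zero _, .zero _⟩
  | one h =>
    obtain ⟨x, hx⟩ := h
    rcases hR hx with h | h
    · exact ⟨1, 0, rfl, .one ⟨x, h⟩, .zero _⟩
    · exact ⟨0, 1, rfl, .zero _, .one ⟨x, h⟩⟩
  | @split R y z X m n h1 h2 ih1 ih2 =>
    have key : ∀ X, W.loops (W.reach R y) z X ⊆
        W.loops (W.reach R₁ y) z X ∪ W.loops (W.reach R₂ y) z X := by
      rintro X t ⟨ht, hl⟩
      obtain ⟨x, hx, hp⟩ := mem_reach.1 ht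
      rcases hR hx with h | h
      · exact .inl ⟨mem_reach.2 ⟨x, h, hp⟩, hl⟩
      · exact .inr ⟨mem_reach.2 ⟨x, h, hp⟩, hl⟩
    obtain ⟨a, b, rfl, ha, hb⟩ := ih1 (key X)
    obtain ⟨c, d, rfl, hc, hd⟩ := ih2 (key Xᶜ)
    exact ⟨a + c, b + d, by omega, .split ha hc, .split hb hd⟩

theorem Branch.eq_zero {n : ℕ} (h : W.Branch ∅ n) : n = 0 := by
  generalize hR : (∅ : Set (Q × G)) = R at h
  induction h with
  | zero => rfl
  | one h => subst hR; simp at h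
  | @split R y z X m n h1 h2 ih1 ih2 =>
    subst hR
    have key : ∀ X, (∅ : Set (Q × G)) = W.loops (W.reach ∅ y) z X := by
      intro X
      symm
      rw [Set.eq_empty_iff_forall_notMem]
      rintro t ⟨ht, -⟩
      obtain ⟨x, hx, -⟩ := mem_reach.1 ht
      exact hx
    rw [ih1 (key _), ih2 (key _)]

/-- A separated family of `n` runs uses at most `n` starting configurations, so that only boundedly
many runs have to be considered simultaneously. -/
theorem Branch.exists_finset {R : Set (Q × G)} {n : ℕ} (h : W.Branch R n) :
    ∃ Z : Finset (Q × G), (Z : Set (Q × G)) ⊆ R ∧ Z.card ≤ n ∧ W.Branch (Z : Set (Q × G)) n := by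
  classical
  induction h with
  | zero => exact ⟨∅, by simp, by simp, .zero _⟩
  | one h =>
    obtain ⟨x, hx⟩ := h
    exact ⟨{x}, by simpa using hx, by simp, .one ⟨x, by simp⟩⟩
  | @split R y z X m n h1 h2 ih1 ih2 =>
    have key : ∀ (X : Set G) (n : ℕ), (∃ Z : Finset (Q × G),
        (Z : Set (Q × G)) ⊆ W.loops (W.reach R y) z X ∧ Z.card ≤ n ∧
          W.Branch (Z : Set (Q × G)) n) →
        ∃ Z : Finset (Q × G), (Z : Set (Q × G)) ⊆ R ∧ Z.card ≤ n ∧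
          W.Branch (W.loops (W.reach (Z : Set (Q × G)) y) z X) n := by
      rintro X n ⟨Z, h1, h2, h3⟩
      obtain ⟨Z', h4, h5, h6⟩ := exists_finset_subset_reach (W := W) Z
        (fun x hx => (h1 hx).1)
      exact ⟨Z', h4, h5.trans h2, h3.mono fun x hx => ⟨h6 hx, (h1 hx).2⟩⟩
    obtain ⟨Z₁, a1, a2, a3⟩ := key _ _ ih1
    obtain ⟨Z₂, b1, b2, b3⟩ := key _ _ ih2
    refine ⟨Z₁ ∪ Z₂, ?_, (Finset.card_union_le _ _).trans (by omega), ?_⟩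
    · rw [Finset.coe_union]; exact Set.union_subset a1 b1
    · rw [Finset.coe_union]
      exact .split (a3.mono (loops_mono (reach_mono Set.subset_union_left _) _ _))
        (b3.mono (loops_mono (reach_mono Set.subset_union_right _) _ _))

/-- There are `n` runs from configurations in `R`, with loops at the end of each segment, any two
of which violate the condition in the branching twinning property at some index `< n - 1`.  The
number of segments is infinite so that families can be extended without padding; only the segments
with index `< n - 1` matter.  In segment `i` the run `j` reads `u i j` from `x i j` to
`x (i + 1) j`, where the loop reads `v i j` and changes the output to `y i j`. -/
def Separated (W : WeightedAutomaton A Q G) (R : Set (Q × G)) (n : ℕ) : Prop :=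
  ∃ (ι : Type) (_ : Fintype ι) (x : ℕ → ι → Q × G) (y : ℕ → ι → G) (u v : ℕ → ι → List A),
    Fintype.card ι = n ∧ (∀ j, x 0 j ∈ R) ∧
    (∀ i j, W.Path (x i j) (u i j) (x (i + 1) j)) ∧
    (∀ i j, W.Path (x (i + 1) j) (v i j) ((x (i + 1) j).1, y i j)) ∧
    ∀ j j', j ≠ j' → ∃ i, i + 1 < n ∧ (∀ i' ≤ i, u i' j = u i' j' ∧ v i' j = v i' j') ∧
      y i j * (x (i + 1) j).2⁻¹ ≠ y i j' * (x (i + 1) j').2⁻¹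

theorem Separated.of_reach {R : Set (Q × G)} {w : List A} {n : ℕ}
    (h : W.Separated (W.reach R w) n) : W.Separated R n := by
  obtain ⟨ι, _, x, y, u, v, hc, h0, hu, hv, hs⟩ := h
  choose r hr hp using fun j => mem_reach.1 (h0 j)
  refine ⟨ι, inferInstance, fun i j => Nat.casesOn i (r j) fun i => x (i + 1) j, y,
    fun i j => Nat.casesOn i (w ++ u 0 j) fun i => u (i + 1) j, v, hc, hr, ?_, hv, ?_⟩
  · rintro (_ | i) j
    · exact (hp j).append (hu 0 j)
    · exact hu (i + 1) j
  · intro j j' hj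
    obtain ⟨i, hi, he, hne⟩ := hs j j' hj
    refine ⟨i, hi, ?_, hne⟩
    rintro (_ | i') hi'
    · exact ⟨congrArg (w ++ ·) (he 0 hi').1, (he 0 hi').2⟩
    · exact he (i' + 1) hi'

/-- At an inner node, the loops of the node become segment `0` of all runs and the segments of both
subtrees are moved up by one.  If one subtree has no leaves, its node is skipped instead, as the
other subtree may already use all segments that are allowed. -/
theorem Branch.separated {R : Set (Q × G)} {n : ℕ} (h : W.Branch R n) : W.Separated R n := by
  induction h with
  | zero R =>
    exact ⟨Empty, inferInstance, fun _ j => j.elim, fun _ j => j.elim, fun _ j => j.elim,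
      fun _ j => j.elim, rfl, fun j => j.elim, fun _ j => j.elim, fun _ j => j.elim,
      fun j => j.elim⟩
  | one h =>
    obtain ⟨x, hx⟩ := h
    exact ⟨Unit, inferInstance, fun _ _ => x, fun _ _ => x.2, fun _ _ => [], fun _ _ => [], rfl,
      fun _ => hx, fun _ _ => .refl x, fun _ _ => .refl x, fun j j' hj => (hj rfl).elim⟩
  | @split R w z X m n h1 h2 ih1 ih2 =>
    have hsub : ∀ X, W.loops (W.reach R w) z X ⊆ W.reach R w := fun X t ht => ht.1
    have mono : ∀ {R R' : Set (Q × G)} {n}, R ⊆ R' → W.Separated R n → W.Separated R' n := by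
      rintro R R' n hR ⟨ι, i, x, y, u, v, hc, h0, h⟩
      exact ⟨ι, i, x, y, u, v, hc, fun j => hR (h0 j), h⟩
    rcases Nat.eq_zero_or_pos m with rfl | hm
    · rw [zero_add]; exact (mono (hsub _) ih2).of_reach
    rcases Nat.eq_zero_or_pos n with rfl | hn
    · exact (mono (hsub _) ih1).of_reach
    obtain ⟨ι₁, _, x₁, y₁, u₁, v₁, c1, h01, hu1, hv1, hs1⟩ := ih1
    obtain ⟨ι₂, _, x₂, y₂, u₂, v₂, c2, h02, hu2, hv2, hs2⟩ := ih2
    choose r1 hr1 hp1 using fun j => mem_reach.1 (h01 j).1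
    choose r2 hr2 hp2 using fun j => mem_reach.1 (h02 j).1
    choose b1 hb1 hX1 using fun j => (h01 j).2
    choose b2 hb2 hX2 using fun j => (h02 j).2
    refine ⟨ι₁ ⊕ ι₂, inferInstance,
      fun i j => Nat.casesOn i (Sum.elim r1 r2 j) fun i => Sum.elim (x₁ i) (x₂ i) j,
      fun i j => Nat.casesOn i (Sum.elim b1 b2 j) fun i => Sum.elim (y₁ i) (y₂ i) j,
      fun i j => Nat.casesOn i w fun i => Sum.elim (u₁ i) (u₂ i) j,
      fun i j => Nat.casesOn i z fun i => Sum.elim (v₁ i) (v₂ i) j,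
      by rw [Fintype.card_sum, c1, c2], ?_, ?_, ?_, ?_⟩
    · rintro (j | j)
      exacts [hr1 j, hr2 j]
    · rintro (_ | i) (j | j)
      exacts [hp1 j, hp2 j, hu1 i j, hu2 i j]
    · rintro (_ | i) (j | j)
      exacts [hb1 j, hb2 j, hv1 i j, hv2 i j]
    · rintro (j | j) (j' | j') hj
      · obtain ⟨i, hi, he, hne⟩ := hs1 j j' (fun h => hj (congrArg _ h))
        refine ⟨i + 1, by omega, ?_, hne⟩
        rintro (_ | i') hi'
        · exact ⟨rfl, rfl⟩
        · exact he i' (by omega)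
      · refine ⟨0, by omega, fun i' hi' => ?_, fun h => ?_⟩
        · obtain rfl : i' = 0 := by omega
          exact ⟨rfl, rfl⟩
        · exact hX2 j' (by have := hX1 j; exact h ▸ this)
      · refine ⟨0, by omega, fun i' hi' => ?_, fun h => ?_⟩
        · obtain rfl : i' = 0 := by omega
          exact ⟨rfl, rfl⟩
        · exact hX2 j (by have := hX1 j'; exact h ▸ this)
      · obtain ⟨i, hi, he, hne⟩ := hs2 j j' (fun h => hj (congrArg _ h))
        refine ⟨i + 1, by omega, ?_, hne⟩
        rintro (_ | i') hi'
        · exact ⟨rfl, rfl⟩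
        · exact he i' (by omega)

theorem BTP.not_branch {k : ℕ} (h : W.BTP k) : ¬ W.Branch W.init (k + 1) := by
  intro hb
  obtain ⟨ι, _, x, y, u, v, hc, h0, hu, hv, hs⟩ := hb.separated
  let e : Fin (k + 1) ≃ ι := (Fintype.equivFinOfCardEq hc).symm
  have hprod : ∀ (j : ι) (i : Fin (k + 1)),
      (x 0 j).2 * Fin.partialProd (fun l : Fin k => (x l j).2⁻¹ * (x (l + 1) j).2) i =
        (x i j).2 := by
    intro j i
    induction i using Fin.induction with
    | zero => simp
    | succ i ih =>
      rw [Fin.partialProd_succ, ← mul_assoc, ih]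
      simp
  obtain ⟨j, j', hj, hd⟩ := h (fun i j => (x i (e j)).1) (fun j => (x 0 (e j)).2)
    (fun i j => u i (e j)) (fun i j => v i (e j))
    (fun i j => (x i (e j)).2⁻¹ * (x (i + 1) (e j)).2)
    (fun i j => (x (i + 1) (e j)).2⁻¹ * y i (e j))
    (fun j => h0 (e j)) (fun i j => hu i (e j)) (fun i j => hv i (e j))
  obtain ⟨i, hi, he, hne⟩ := hs (e j) (e j') (fun h => hj (e.injective h))
  have := hd ⟨i, by omega⟩ (fun i' hi' => he i' hi')
  rw [hprod, hprod] at this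
  apply hne
  simp only [Fin.val_succ, delay, mul_inv_cancel_left] at this
  rw [eq_inv_mul_iff_mul_eq, ← mul_assoc] at this
  rw [← this]
  group

end WeightedAutomaton

namespace WeightedAutomaton

open scoped Pointwise

variable {A : Type u} {Q : Type v} {G : Type w} [Group G] {W : WeightedAutomaton A Q G}

/-! ### Simultaneous runs and their common loops -/

/-- The configurations `f t` that a run passes through at the times `t ≤ y.length`. -/
theorem Path.exists_trajectory {x z : Q × G} {y : List A} (h : W.Path x y z) :
    ∃ f : ℕ → Q × G, f 0 = x ∧ f y.length = z ∧
      ∀ s t, s ≤ t → t ≤ y.length → W.Path (f s) ((y.take t).drop s) (f t) := by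
  induction y generalizing x with
  | nil =>
    rw [path_nil] at h
    subst h
    refine ⟨fun _ => x, rfl, rfl, fun s t _ _ => ?_⟩
    simpa using Path.refl x
  | cons a y ih =>
    obtain ⟨r, h1, h2⟩ := path_cons.1 h
    obtain ⟨f, hf0, hf, hp⟩ := ih h2
    refine ⟨fun n => Nat.casesOn n x f, rfl, hf, ?_⟩
    rintro (_ | s) (_ | t) hst ht
    · exact .refl x
    · refine path_cons.2 ⟨r, h1, ?_⟩
      have := hp 0 t (Nat.zero_le _) (by simpa using ht)
      rwa [hf0, List.drop_zero] at this
    · omega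
    · simpa using hp s t (by omega) (by simpa using ht)

/-- The runs `j` on the word `y` (in configuration `x t j` at time `t`) are coloured, and any two
runs of different colours are told apart by a loop common to all of them, at a time `≥ s`.  Then the
families of runs that continue the runs of one colour can be merged into one separated family.
The loops are used in the order of their starting times, each one dividing the runs further. -/
theorem branch_sum_of_separated_colors {ι κ : Type*} [Fintype κ] {y : List A}
    {x : ℕ → ι → Q × G}
    (hx : ∀ j s t, s ≤ t → t ≤ y.length → W.Path (x s j) ((y.take t).drop s) (x t j))
    (col : ι → κ) (m : ℕ) : ∀ (Y : Finset ι) (n : κ → ℕ) (s : ℕ), Y.card = m → s ≤ y.length →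
      (∀ j ∈ Y, ∀ j' ∈ Y, col j ≠ col j' → ∃ s' t, s ≤ s' ∧ s' ≤ t ∧ t ≤ y.length ∧
        (∀ i, (x s' i).1 = (x t i).1) ∧
        (x t j).2 * (x s' j).2⁻¹ ≠ (x t j').2 * (x s' j').2⁻¹) →
      (∀ c, W.Branch {z | ∃ j ∈ Y, col j = c ∧ x y.length j = z} (n c)) →
      W.Branch {z | ∃ j ∈ Y, x s j = z} (∑ c, n c) := by
  classical
  induction m using Nat.strong_induction_on with
  | _ m ih =>
  intro Y n s hm hs hsep hn
  by_cases hcol : ∃ s', s ≤ s' ∧ ∃ t, s' ≤ t ∧ t ≤ y.length ∧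
      (∀ i, (x s' i).1 = (x t i).1) ∧ ∃ j ∈ Y, ∃ j' ∈ Y, col j ≠ col j' ∧
        (x t j).2 * (x s' j).2⁻¹ ≠ (x t j').2 * (x s' j').2⁻¹
  · -- the first loop that tells apart two runs of different colours
    have hmin := fun r => Nat.find_min (m := r) hcol
    obtain ⟨hs', t, ht, hty, hloop, j, hj, j', hj', -, hne⟩ := Nat.find_spec hcol
    set s' := Nat.find hcol
    let X : Set G := {(x t j).2 * (x s' j).2⁻¹}
    let Y₁ := Y.filter fun i => (x t i).2 * (x s' i).2⁻¹ ∈ X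
    let Y₂ := Y.filter fun i => ¬ (x t i).2 * (x s' i).2⁻¹ ∈ X
    have hY₁ : Y₁ ⊂ Y := Finset.filter_ssubset.2 ⟨j', hj', fun h => hne (Eq.symm h)⟩
    have hY₂ : Y₂ ⊂ Y := Finset.filter_ssubset.2 ⟨j, hj, fun h => h rfl⟩
    have hsplit : ∀ c, ∃ n₁ n₂, n c = n₁ + n₂ ∧
        W.Branch {z | ∃ j ∈ Y₁, col j = c ∧ x y.length j = z} n₁ ∧
        W.Branch {z | ∃ j ∈ Y₂, col j = c ∧ x y.length j = z} n₂ := by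
      intro c
      refine (hn c).exists_add ?_
      rintro z ⟨i, hi, hc, rfl⟩
      by_cases h : (x t i).2 * (x s' i).2⁻¹ ∈ X
      · exact .inl ⟨i, Finset.mem_filter.2 ⟨hi, h⟩, hc, rfl⟩
      · exact .inr ⟨i, Finset.mem_filter.2 ⟨hi, h⟩, hc, rfl⟩
    choose n₁ n₂ hadd hn₁ hn₂ using hsplit
    have hrec : ∀ Y' ⊂ Y, ∀ n' : κ → ℕ,
        (∀ c, W.Branch {z | ∃ j ∈ Y', col j = c ∧ x y.length j = z} (n' c)) →
        W.Branch {z | ∃ j ∈ Y', x s' j = z} (∑ c, n' c) := by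
      intro Y' hY' n' hn'
      refine ih _ (hm ▸ Finset.card_lt_card hY') Y' n' s' rfl (ht.trans hty) ?_ hn'
      intro i hi i' hi' hc
      obtain ⟨r, t', h1, h2, h3, h4, h5⟩ := hsep i (hY'.1 hi) i' (hY'.1 hi') hc
      refine ⟨r, t', ?_, h2, h3, h4, h5⟩
      by_contra hr
      exact hmin r (not_le.1 hr) ⟨h1, t', h2, h3, h4, i, hY'.1 hi, i', hY'.1 hi', hc, h5⟩
    have hb₁ := hrec Y₁ hY₁ n₁ hn₁
    have hb₂ := hrec Y₂ hY₂ n₂ hn₂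
    have hsum : ∑ c, n c = ∑ c, n₁ c + ∑ c, n₂ c := by
      rw [← Finset.sum_add_distrib]
      exact Finset.sum_congr rfl fun c _ => hadd c
    rw [hsum]
    have hsub : ∀ i ∈ Y, x s' i ∈ W.reach {z | ∃ j ∈ Y, x s j = z} ((y.take s').drop s) :=
      fun i hi => mem_reach.2 ⟨x s i, ⟨i, hi, rfl⟩, hx i s s' hs' (ht.trans hty)⟩
    have hlp : ∀ i, W.Path (x s' i) ((y.take t).drop s') ((x s' i).1, (x t i).2) := by
      intro i
      have := hx i s' t ht hty
      rw [hloop i]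
      exact this
    refine Branch.split (y := (y.take s').drop s) (z := (y.take t).drop s') (X := X)
      (hb₁.mono ?_) (hb₂.mono ?_)
    · rintro z ⟨i, hi, rfl⟩
      obtain ⟨hi, hX⟩ := Finset.mem_filter.1 hi
      exact ⟨hsub i hi, (x t i).2, hlp i, hX⟩
    · rintro z ⟨i, hi, rfl⟩
      obtain ⟨hi, hX⟩ := Finset.mem_filter.1 hi
      exact ⟨hsub i hi, (x t i).2, hlp i, hX⟩
  · -- all runs have the same colour
    have hmono : ∀ j ∈ Y, ∀ j' ∈ Y, col j = col j' := by
      intro j hj j' hj'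
      by_contra hc
      obtain ⟨s', t, h1, h2, h3, h4, h5⟩ := hsep j hj j' hj' hc
      exact hcol ⟨s', h1, t, h2, h3, h4, j, hj, j', hj', hc, h5⟩
    have hzero : ∀ c, (∀ j ∈ Y, col j ≠ c) → n c = 0 := by
      intro c hc
      have := hn c
      have he : {z | ∃ j ∈ Y, col j = c ∧ x y.length j = z} = (∅ : Set (Q × G)) := by
        rw [Set.eq_empty_iff_forall_notMem]
        rintro z ⟨j, hj, h, -⟩
        exact hc j hj h
      rw [he] at this
      exact this.eq_zero
    rcases Y.eq_empty_or_nonempty with rfl | ⟨j, hj⟩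
    · rw [Finset.sum_eq_zero fun c _ => hzero c (by simp)]
      exact .zero _
    · rw [Fintype.sum_eq_single (col j) fun c hc => hzero c fun j' hj' h =>
        hc (h.symm.trans (hmono j' hj' j hj))]
      refine (((hn (col j)).mono ?_).of_reach (y := (y.take y.length).drop s))
      rintro z ⟨i, hi, -, rfl⟩
      exact mem_reach.2 ⟨x s i, ⟨i, hi, rfl⟩, hx i s _ hs le_rfl⟩

/-! ### Runs with a large delay -/

/-- The elements that arise from `D` by at most `n` operations `d ↦ β⁻¹ * d * β'` with
`β, β' ∈ B`. -/
def spread (D B : Set G) : ℕ → Set G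
  | 0 => D
  | n + 1 => spread D B n ∪ B⁻¹ * spread D B n * B

theorem spread_mono (D B : Set G) : Monotone (spread D B) :=
  monotone_nat_of_le_succ fun _ => Set.subset_union_left

theorem finite_spread {D B : Set G} (hD : D.Finite) (hB : B.Finite) (n : ℕ) :
    (spread D B n).Finite := by
  induction n with
  | zero => exact hD
  | succ n ih => exact ih.union ((hB.inv.mul ih).mul hB)

/-- If `d t` is determined by `P t`, then the final value of `d` can be computed along the sequence
`P` with its loops removed. -/
theorem mem_spread_of_determined {K : Type*} {D B : Set G} {P : ℕ → K} {d : ℕ → G} {l : ℕ}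
    (hd : ∀ t < l, ∃ β ∈ B, ∃ β' ∈ B, d (t + 1) = β⁻¹ * d t * β')
    (hP : ∀ s t, s ≤ t → t ≤ l → P s = P t → d s = d t) (m : ℕ) :
    ∀ (V : Finset K) (s i : ℕ), V.card = m → s ≤ l → (∀ t, s ≤ t → t ≤ l → P t ∈ V) →
      d s ∈ spread D B i → d l ∈ spread D B (i + m) := by
  classical
  induction m with
  | zero =>
    intro V s i hV hs h _
    rw [Finset.card_eq_zero] at hV
    subst hV
    simpa using h s le_rfl hs
  | succ m ih =>
    intro V s i hV hs h hds
    have hex : ∃ t ≤ l, s ≤ t ∧ P t = P s ∧ ∀ r, t < r → r ≤ l → P r ≠ P s := by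
      have h1 := Nat.findGreatest_spec (P := fun t => s ≤ t ∧ P t = P s) hs ⟨le_rfl, rfl⟩
      refine ⟨_, Nat.findGreatest_le l, h1.1, h1.2, fun r hr hrl he => ?_⟩
      exact Nat.findGreatest_is_greatest hr hrl ⟨h1.1.trans hr.le, he⟩
    -- the last visit to the state `P s`
    obtain ⟨t, htl, hst, hPt, hlast⟩ := hex
    have hdt : d t ∈ spread D B i := hP s t hst htl hPt.symm ▸ hds
    rcases htl.eq_or_lt with rfl | htl
    · exact spread_mono D B (by omega) hdt
    · have := ih (V.erase (P s)) (t + 1) (i + 1)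
        (by rw [Finset.card_erase_of_mem (h s le_rfl hs), hV]; rfl) htl
        (fun r hr hrl => Finset.mem_erase.2 ⟨hlast r hr hrl, h r (by omega) hrl⟩) ?_
      · rwa [show i + (m + 1) = i + 1 + m by omega]
      · obtain ⟨β, hβ, β', hβ', he⟩ := hd t htl
        rw [he]
        exact .inr (Set.mul_mem_mul (Set.mul_mem_mul (Set.inv_mem_inv.2 hβ) hdt) hβ')

/-- The weights of the transitions of an automaton. -/
def weights (W : WeightedAutomaton A Q G) : Set G := (fun t => t.2.2.1) '' W.trans

/-- The delays between the configurations in `R`. -/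
def delays (R : Set (Q × G)) : Set G := Set.image2 (fun x z => delay x.2 z.2) R R

/-- Two simultaneous runs that end with a large delay are told apart by a loop common to a given
family of runs. -/
theorem exists_loop_of_delay_notMem_spread {ι : Type*} [Finite ι] [Finite Q] {y : List A}
    {x : ℕ → ι → Q × G}
    (hx : ∀ j s t, s ≤ t → t ≤ y.length → W.Path (x s j) ((y.take t).drop s) (x t j))
    {D : Set G} {N : ℕ} (hN : Nat.card (ι → Q) ≤ N) {j j' : ι}
    (h0 : delay (x 0 j).2 (x 0 j').2 ∈ D)
    (hfar : delay (x y.length j).2 (x y.length j').2 ∉ spread D W.weights N) :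
    ∃ s t, s ≤ t ∧ t ≤ y.length ∧ (∀ i, (x s i).1 = (x t i).1) ∧
      (x t j).2 * (x s j).2⁻¹ ≠ (x t j').2 * (x s j').2⁻¹ := by
  classical
  by_contra hcon
  push Not at hcon
  apply hfar
  have : Fintype (ι → Q) := Fintype.ofFinite _
  rw [Nat.card_eq_fintype_card] at hN
  refine spread_mono _ _ (show 0 + Fintype.card (ι → Q) ≤ N by omega) ?_
  refine mem_spread_of_determined (P := fun t i => (x t i).1)
    (d := fun t => delay (x t j).2 (x t j').2) ?_ ?_ _ Finset.univ 0 0 Finset.card_univ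
    (Nat.zero_le _) (fun _ _ _ => Finset.mem_univ _) h0
  · intro t ht
    have hstep : ∀ j, (x t j).2⁻¹ * (x (t + 1) j).2 ∈ W.weights := by
      intro j
      have h1 := hx j t (t + 1) (Nat.le_succ _) ht
      have h2 : (y.take (t + 1)).drop t = [y[t]] := by
        rw [List.take_add_one, List.getElem?_eq_getElem ht, List.drop_append]
        simp [ht.le]
      rw [h2, path_cons] at h1
      obtain ⟨r, h3, h4⟩ := h1
      rw [path_nil] at h4
      subst h4
      exact ⟨_, h3, rfl⟩
    refine ⟨_, hstep j, _, hstep j', ?_⟩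
    simp only [delay]
    group
  · intro s t hst ht hP
    have := hcon s t hst ht (congrFun hP)
    simp only [delay]
    rw [eq_inv_mul_iff_mul_eq, ← mul_assoc, this]
    group

/-- Separated families that start from sets of configurations with large mutual delays can be
merged. -/
theorem branch_sum_of_far [Finite Q] {S : Set (Q × G)} {y : List A} {N : ℕ} {κ : Type*}
    [Fintype κ] (Z : Finset (Q × G)) (hZ : (Z : Set (Q × G)) ⊆ W.reach S y)
    (hN : (Nat.card Q + 1) ^ Z.card ≤ N) (col : Q × G → κ) (n : κ → ℕ)
    (hfar : ∀ z ∈ Z, ∀ z' ∈ Z, col z ≠ col z' →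
      delay z.2 z'.2 ∉ spread (delays S) W.weights N ∨
        delay z'.2 z.2 ∉ spread (delays S) W.weights N)
    (hn : ∀ c, W.Branch {z | z ∈ Z ∧ col z = c} (n c)) : W.Branch S (∑ c, n c) := by
  have h1 : ∀ z : Z, ∃ f : ℕ → Q × G, f 0 ∈ S ∧ f y.length = z ∧
      ∀ s t, s ≤ t → t ≤ y.length → W.Path (f s) ((y.take t).drop s) (f t) := by
    intro z
    obtain ⟨x, hx, hp⟩ := mem_reach.1 (hZ z.2)
    obtain ⟨f, hf, h⟩ := hp.exists_trajectory
    exact ⟨f, hf ▸ hx, h⟩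
  choose f hf0 hf hp using h1
  have hN' : Nat.card (Z → Q) ≤ N := by
    refine le_trans ?_ hN
    rw [Nat.card_fun, Nat.card_eq_fintype_card (α := Z), Fintype.card_coe]
    exact Nat.pow_le_pow_left (Nat.le_succ _) _
  have h2 := branch_sum_of_separated_colors (W := W) (y := y) (x := fun t z => f z t)
    (fun j => hp j) (fun z : Z => col z) _ Finset.univ n 0 rfl (Nat.zero_le _) ?_ ?_
  · refine h2.mono ?_
    rintro z ⟨j, -, rfl⟩
    exact hf0 j
  · intro j _ j' _ hc
    have hsep : ∀ j j' : Z, delay j.1.2 j'.1.2 ∉ spread (delays S) W.weights N →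
        ∃ s t, s ≤ t ∧ t ≤ y.length ∧ (∀ i, (f i s).1 = (f i t).1) ∧
        (f j t).2 * (f j s).2⁻¹ ≠ (f j' t).2 * (f j' s).2⁻¹ := by
      intro j j' h
      refine exists_loop_of_delay_notMem_spread (x := fun t z => f z t) hp
        (D := delays S) hN'
        ⟨_, hf0 j, _, hf0 j', rfl⟩ ?_
      simpa only [hf] using h
    rcases hfar j j.2 j' j'.2 hc with h | h
    · obtain ⟨s, t, a, b, c, d⟩ := hsep j j' h
      exact ⟨s, t, Nat.zero_le _, a, b, c, d⟩
    · obtain ⟨s, t, a, b, c, d⟩ := hsep j' j h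
      exact ⟨s, t, Nat.zero_le _, a, b, c, d.symm⟩
  · intro c
    refine (hn c).mono ?_
    rintro z ⟨hz, hc⟩
    exact ⟨⟨z, hz⟩, Finset.mem_univ _, hc, hf ⟨z, hz⟩⟩

/-- If `S` does not have `k + 1` separated runs and the set of configurations reached from `S` by
a word has a large delay, then this set can be divided into two parts between which the bound `k`
can be distributed. -/
theorem exists_split_of_far [Finite Q] {S : Set (Q × G)} (hS : S.Finite) {k : ℕ}
    (hk : ¬ W.Branch S (k + 1)) :
    ∃ F : Set G, F.Finite ∧ ∀ y : List A, ∀ r ∈ W.reach S y, ∀ r' ∈ W.reach S y,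
      delay r.2 r'.2 ∉ F → ∃ (R R' : Set (Q × G)) (k₁ k₂ : ℕ), W.reach S y = R ∪ R' ∧
        k₁ + k₂ = k ∧ k₁ < k ∧ k₂ < k ∧
        ¬ W.Branch R (k₁ + 1) ∧ ¬ W.Branch R' (k₂ + 1) := by
  classical
  set N := (Nat.card Q + 1) ^ (2 * k + 1) with hN
  set F₀ : Set G := insert 1 (spread (delays S) W.weights N) with hF₀
  have hF₀fin : F₀.Finite :=
    (finite_spread (hS.image2 _ hS) (W.trans_finite.image _) N).insert 1
  have h1 : (1 : G) ∈ F₀ := Set.mem_insert _ _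
  have hNle : ∀ m ≤ 2 * k + 1, (Nat.card Q + 1) ^ m ≤ N := fun m hm =>
    Nat.pow_le_pow_right (Nat.succ_pos _) hm
  have hmono : ∀ {i j : ℕ}, i ≤ j → F₀ ^ i ⊆ F₀ ^ j := fun h =>
    Set.pow_subset_pow_right h1 h
  have hfin : ∀ n : ℕ, (F₀ ^ n).Finite := by
    intro n
    induction n with
    | zero => rw [pow_zero]; exact Set.finite_one
    | succ n ih => rw [pow_succ]; exact ih.mul hF₀fin
  refine ⟨F₀ ^ (2 * k), hfin _, ?_⟩
  intro y r hr r' hr' hfar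
  have hle : ∀ R ⊆ W.reach S y, ∀ n, W.Branch R n → n ≤ k := by
    intro R hR n hn
    by_contra h
    exact hk (((hn.mono hR).of_reach).of_le (by omega))
  by_cases hgap : ∃ i < 2 * k, ∀ z ∈ W.reach S y, delay r.2 z.2 ∈ F₀ ^ (i + 1) →
      delay r.2 z.2 ∈ F₀ ^ i
  · -- no configuration has a distance between `i` and `i + 1` from `r`
    obtain ⟨i, hi, hgap⟩ := hgap
    set R : Set (Q × G) := {z | z ∈ W.reach S y ∧ delay r.2 z.2 ∈ F₀ ^ i}
    set R' : Set (Q × G) := {z | z ∈ W.reach S y ∧ delay r.2 z.2 ∉ F₀ ^ i}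
    have hrR : r ∈ R := ⟨hr, by
      rw [delay, inv_mul_cancel]
      have := hmono (Nat.zero_le i)
      rw [pow_zero] at this
      exact this rfl⟩
    have hrR' : r' ∈ R' := ⟨hr', fun h => hfar (hmono hi.le h)⟩
    have hRS : R ⊆ W.reach S y := fun z hz => hz.1
    have hRS' : R' ⊆ W.reach S y := fun z hz => hz.1
    set k₁ := Nat.findGreatest (fun n => W.Branch R n) k
    set k₂ := Nat.findGreatest (fun n => W.Branch R' n) k
    have hk₁ : W.Branch R k₁ := Nat.findGreatest_spec (P := fun n => W.Branch R n)
      (Nat.zero_le k) (.zero _)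
    have hk₂ : W.Branch R' k₂ := Nat.findGreatest_spec (P := fun n => W.Branch R' n)
      (Nat.zero_le k) (.zero _)
    have hmax₁ : ∀ n, W.Branch R n → n ≤ k₁ := fun n h => Nat.le_findGreatest (hle R hRS n h) h
    have hmax₂ : ∀ n, W.Branch R' n → n ≤ k₂ := fun n h => Nat.le_findGreatest (hle R' hRS' n h) h
    have hone₁ : 1 ≤ k₁ := hmax₁ 1 (.one ⟨r, hrR⟩)
    have hone₂ : 1 ≤ k₂ := hmax₂ 1 (.one ⟨r', hrR'⟩)
    have hcross : ∀ z ∈ R, ∀ z' ∈ R', delay z.2 z'.2 ∉ spread (delays S) W.weights N := by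
      intro z hz z' hz' h
      refine hz'.2 (hgap z' hz'.1 ?_)
      have := Set.mul_mem_mul hz.2 (Set.mem_insert_of_mem 1 h)
      rw [pow_succ]
      convert this using 1
      simp [delay, mul_assoc]
    have hsum : k₁ + k₂ ≤ k := by
      obtain ⟨Z₁, a1, a2, a3⟩ := hk₁.exists_finset
      obtain ⟨Z₂, b1, b2, b3⟩ := hk₂.exists_finset
      have hZ₁ : ∀ z ∈ Z₁, z ∈ R := a1
      have hZ₂ : ∀ z ∈ Z₂, z ∈ R' := b1
      have := branch_sum_of_far (W := W) (S := S) (y := y) (N := N) (Z₁ ∪ Z₂)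
        (by rw [Finset.coe_union]; exact Set.union_subset (a1.trans hRS) (b1.trans hRS'))
        (hNle _ ((Finset.card_union_le _ _).trans (by
          have := hle R hRS _ hk₁
          have := hle R' hRS' _ hk₂
          omega)))
        (fun z => decide (z ∈ R)) (fun b => bif b then k₁ else k₂) ?_ ?_
      · simp only [Fintype.sum_bool, cond_true, cond_false] at this
        by_contra h
        exact hk (this.of_le (by omega))
      · intro z hz z' hz' hc
        have mem : ∀ z ∈ Z₁ ∪ Z₂, z ∉ R → z ∈ R' := by
          intro z hz h
          rcases Finset.mem_union.1 hz with h' | h'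
          · exact absurd (hZ₁ z h') h
          · exact hZ₂ z h'
        by_cases h : z ∈ R
        · have h' : z' ∉ R := fun h' => hc (by simp [h, h'])
          exact .inl (hcross z h z' (mem z' hz' h'))
        · have h' : z' ∈ R := by
            by_contra h'
            exact hc (by simp [h, h'])
          exact .inr (hcross z' h' z (mem z hz h))
      · rintro (_ | _)
        · refine b3.mono fun z hz => ⟨Finset.mem_union_right _ hz, ?_⟩
          exact decide_eq_false fun h => (hZ₂ z hz).2 h.2
        · refine a3.mono fun z hz => ⟨Finset.mem_union_left _ hz, ?_⟩
          exact decide_eq_true (hZ₁ z hz)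
    refine ⟨R, R', k₁, k - k₁, ?_, by omega, by omega, by omega, fun h => ?_, fun h => ?_⟩
    · ext z
      simp only [R, R', Set.mem_union, Set.mem_ofPred_eq]
      tauto
    · have := hmax₁ _ h
      omega
    · have := hmax₂ _ h
      omega
  · -- configurations at the distances `0, 2, …, 2 * k` from `r` have large mutual delays
    exfalso
    push Not at hgap
    have hex : ∀ a : Fin (k + 1), ∃ z ∈ W.reach S y, delay r.2 z.2 ∈ F₀ ^ (2 * (a : ℕ)) ∧
        ∀ i < 2 * (a : ℕ), delay r.2 z.2 ∉ F₀ ^ i := by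
      rintro ⟨_ | a, ha⟩
      · refine ⟨r, hr, ?_, fun i hi => by simp at hi⟩
        simp [delay]
      · obtain ⟨z, hz, h1, h2⟩ := hgap (2 * a + 1) (by omega)
        exact ⟨z, hz, h1, fun i hi h => h2 (hmono (by simp at hi; omega) h)⟩
    choose z hz hin hout using hex
    have hdist : ∀ a b : Fin (k + 1), a < b → delay (z a).2 (z b).2 ∉ F₀ := by
      intro a b hab h
      refine hout b (2 * a + 1) (by have : (a : ℕ) < b := hab
                                    omega) ?_
      have := Set.mul_mem_mul (hin a) h
      rw [pow_succ]
      convert this using 1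
      simp [delay, mul_assoc]
    have hinj : Function.Injective z := by
      intro a b hab
      by_contra hne
      rcases lt_or_gt_of_ne hne with h | h
      · exact hdist a b h (by rw [hab, delay, inv_mul_cancel]; exact h1)
      · exact hdist b a h (by rw [hab, delay, inv_mul_cancel]; exact h1)
    have := branch_sum_of_far (W := W) (S := S) (y := y) (N := N) (Finset.univ.image z)
      (by intro t ht
          simp only [Finset.coe_image, Finset.coe_univ, Set.image_univ, Set.mem_range] at ht
          obtain ⟨a, rfl⟩ := ht
          exact hz a)
      (hNle _ (Finset.card_image_le.trans (by rw [Finset.card_univ, Fintype.card_fin]; omega)))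
      (Function.invFun z) (fun _ => 1) ?_ ?_
    · rw [Finset.sum_const, Finset.card_univ, Fintype.card_fin, smul_eq_mul, mul_one] at this
      exact hk this
    · intro t ht t' ht' hc
      simp only [Finset.mem_image, Finset.mem_univ, true_and] at ht ht'
      obtain ⟨a, rfl⟩ := ht
      obtain ⟨b, rfl⟩ := ht'
      have hab : a ≠ b := fun h => hc (by rw [h])
      rcases lt_or_gt_of_ne hab with h | h
      · exact .inl fun h' => hdist a b h (Set.mem_insert_of_mem _ h')
      · exact .inr fun h' => hdist b a h (Set.mem_insert_of_mem _ h')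
    · intro c
      exact .one ⟨z c, by simp, Function.leftInverse_invFun hinj c⟩

end WeightedAutomaton

namespace WeightedAutomaton

variable {A : Type u} {Q : Type v} {G : Type w} [Group G] {W : WeightedAutomaton A Q G}

/-! ### Distributing a bound on the number of runs -/

/-- Multiplication of the outputs of configurations by `g` from the left. -/
def shift (g : G) (R : Set (Q × G)) : Set (Q × G) := {x | (x.1, g⁻¹ * x.2) ∈ R}

theorem mem_shift {g : G} {R : Set (Q × G)} {x : Q × G} :
    x ∈ shift g R ↔ (x.1, g⁻¹ * x.2) ∈ R := Iff.rfl

theorem shift_shift (g h : G) (R : Set (Q × G)) : shift g (shift h R) = shift (g * h) R := by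
  ext x
  simp [mem_shift, mul_assoc]

theorem shift_one (R : Set (Q × G)) : shift 1 R = R := by
  ext x
  simp [mem_shift]

theorem shift_empty (g : G) : shift g (∅ : Set (Q × G)) = ∅ := rfl

theorem step_shift (g : G) (R : Set (Q × G)) (a : A) :
    W.step (shift g R) a = shift g (W.step R a) := by
  ext z
  constructor
  · rintro ⟨x, hx, ht⟩
    refine ⟨_, hx, ?_⟩
    simpa [mul_assoc] using ht
  · rintro ⟨x, hx, ht⟩
    refine ⟨(x.1, g * x.2), ?_, ?_⟩
    · simpa [mem_shift] using hx
    · simpa [mul_assoc] using ht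

theorem step_empty (a : A) : W.step ∅ a = ∅ := by
  ext z
  simp [step]

theorem finite_step {R : Set (Q × G)} (hR : R.Finite) (a : A) : (W.step R a).Finite := by
  refine (hR.image2 (fun x t => (t.2.2.2, x.2 * t.2.2.1)) W.trans_finite).subset ?_
  rintro z ⟨x, hx, ht⟩
  exact ⟨x, hx, _, ht, by simp⟩

/-- A set `T` of pairs `(R, d)`, in which `d` is the number of deterministic runs that are to
simulate the runs from the configurations in `R`, is closed if after each letter, and up to a
shift, the configurations and the number `d` can be distributed over two pairs in `T`.  The pair
`(∅, 0)` covers the case in which nothing is divided. -/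
def IsDistribution (W : WeightedAutomaton A Q G) (T : Set (Set (Q × G) × ℕ)) : Prop :=
  ∀ N ∈ T, N.1.Finite ∧ (N.2 = 0 → N.1 = ∅) ∧
    ∀ a, ∃ N₁ ∈ T, ∃ N₂ ∈ T, ∃ g, N₁.2 + N₂.2 = N.2 ∧ W.step N.1 a = shift g (N₁.1 ∪ N₂.1)

theorem isDistribution_empty : W.IsDistribution {(∅, 0)} := by
  rintro N rfl
  refine ⟨Set.finite_empty, fun _ => rfl, fun a => ⟨_, rfl, _, rfl, 1, rfl, ?_⟩⟩
  rw [step_empty, Set.union_self, shift_empty]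

/-- As long as the delays remain in a fixed finite set, only finitely many sets of configurations
occur, up to shifts.  When a larger delay occurs, the set of configurations is divided and the
parts are treated by induction on the number of runs. -/
theorem exists_isDistribution [Finite A] [Finite Q] (k : ℕ) : ∀ S : Set (Q × G), S.Finite →
    ¬ W.Branch S (k + 1) → ∃ T, T.Finite ∧ W.IsDistribution T ∧ (S, k) ∈ T := by
  induction k using Nat.strong_induction_on with
  | _ k ih =>
  intro S hS hk
  rcases Nat.eq_zero_or_pos k with rfl | hpos
  · obtain rfl : S = ∅ := by
      by_contra h
      exact hk (.one (Set.nonempty_iff_ne_empty.2 h))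
    exact ⟨_, Set.finite_singleton _, isDistribution_empty, rfl⟩
  obtain ⟨F, hF, hsplit⟩ := exists_split_of_far hS hk
  let T₀ : Set (Set (Q × G)) :=
    insert S {R | (∃ g y, R = shift g (W.reach S y)) ∧ R ⊆ Set.univ ×ˢ F}
  have hfinF : (Set.univ ×ˢ F : Set (Q × G)).Finite := Set.finite_univ.prod hF
  have hT₀ : T₀.Finite := (hfinF.finite_subsets.subset fun R hR => hR.2).insert S
  have hform : ∀ R ∈ T₀, ∃ g y, R = shift g (W.reach S y) := by
    rintro R (rfl | ⟨h, -⟩)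
    · exact ⟨1, [], (shift_one R).symm⟩
    · exact h
  have hstep : ∀ R : T₀, ∀ a : A, ∃ T : Set (Set (Q × G) × ℕ), T.Finite ∧ W.IsDistribution T ∧
      ∃ N₁ ∈ T ∪ T₀ ×ˢ {k} ∪ {(∅, 0)}, ∃ N₂ ∈ T ∪ T₀ ×ˢ {k} ∪ {(∅, 0)}, ∃ g,
        N₁.2 + N₂.2 = k ∧ W.step R a = shift g (N₁.1 ∪ N₂.1) := by
    rintro ⟨R, hR⟩ a
    obtain ⟨g, y, rfl⟩ := hform R hR
    have hst : W.step (shift g (W.reach S y)) a = shift g (W.reach S (y ++ [a])) := by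
      rw [step_shift, reach_concat]
    by_cases hfar : ∃ r ∈ W.reach S (y ++ [a]), ∃ r' ∈ W.reach S (y ++ [a]), delay r.2 r'.2 ∉ F
    · obtain ⟨r, hr, r', hr', h⟩ := hfar
      obtain ⟨R₁, R₂, k₁, k₂, hU, hsum, h₁, h₂, hb₁, hb₂⟩ := hsplit _ r hr r' hr' h
      have hfin : (W.reach S (y ++ [a])).Finite := by
        have : ∀ y, (W.reach S y).Finite := by
          intro y
          induction y using List.reverseRecOn with
          | nil => exact hS
          | append_singleton y a ih => rw [reach_concat]; exact finite_step ih a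
        exact this _
      rw [hU] at hfin
      obtain ⟨T₁, hf₁, hd₁, hm₁⟩ := ih k₁ h₁ R₁ (hfin.subset Set.subset_union_left) hb₁
      obtain ⟨T₂, hf₂, hd₂, hm₂⟩ := ih k₂ h₂ R₂ (hfin.subset Set.subset_union_right) hb₂
      refine ⟨T₁ ∪ T₂, hf₁.union hf₂, ?_, (R₁, k₁), .inl (.inl (.inl hm₁)), (R₂, k₂),
        .inl (.inl (.inr hm₂)), g, hsum, hst.trans (by rw [hU])⟩
      rintro N (hN | hN)
      · obtain ⟨a1, a2, a3⟩ := hd₁ N hN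
        refine ⟨a1, a2, fun b => ?_⟩
        obtain ⟨N₁, c1, N₂, c2, c3⟩ := a3 b
        exact ⟨N₁, .inl c1, N₂, .inl c2, c3⟩
      · obtain ⟨a1, a2, a3⟩ := hd₂ N hN
        refine ⟨a1, a2, fun b => ?_⟩
        obtain ⟨N₁, c1, N₂, c2, c3⟩ := a3 b
        exact ⟨N₁, .inr c1, N₂, .inr c2, c3⟩
    · push Not at hfar
      refine ⟨∅, Set.finite_empty, fun N hN => hN.elim, ?_⟩
      rcases (W.reach S (y ++ [a])).eq_empty_or_nonempty with he | ⟨r, hr⟩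
      · refine ⟨(∅, k), .inl (.inr ⟨.inr ⟨⟨1, y ++ [a], ?_⟩, Set.empty_subset _⟩, rfl⟩),
          (∅, 0), .inr rfl, 1, rfl, ?_⟩
        · rw [he, shift_empty]
        · rw [Set.union_self, hst, he, shift_empty, shift_empty]
      · refine ⟨(shift r.2⁻¹ (W.reach S (y ++ [a])), k),
          .inl (.inr ⟨.inr ⟨⟨_, _, rfl⟩, ?_⟩, rfl⟩), (∅, 0), .inr rfl, g * r.2, rfl, ?_⟩
        · intro z hz
          refine ⟨Set.mem_univ _, ?_⟩
          have := hfar r hr _ hz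
          simpa [delay] using this
        · rw [Set.union_empty, hst, shift_shift, mul_inv_cancel_right]
  choose T hTf hTd hT using hstep
  have : Finite T₀ := hT₀
  refine ⟨(⋃ R, ⋃ a, T R a) ∪ T₀ ×ˢ {k} ∪ {(∅, 0)}, ?_, ?_, ?_⟩
  · exact ((Set.finite_iUnion fun R => Set.finite_iUnion fun a => hTf R a).union
      (hT₀.prod (Set.finite_singleton k))).union (Set.finite_singleton _)
  · rintro N ((hN | ⟨hN, hNk⟩) | hN)
    · obtain ⟨R, a, hN⟩ : ∃ R a, N ∈ T R a := by simpa using hN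
      obtain ⟨a1, a2, a3⟩ := hTd R a N hN
      refine ⟨a1, a2, fun b => ?_⟩
      obtain ⟨N₁, c1, N₂, c2, c3⟩ := a3 b
      exact ⟨N₁, .inl (.inl (Set.mem_iUnion₂.2 ⟨R, a, c1⟩)), N₂,
        .inl (.inl (Set.mem_iUnion₂.2 ⟨R, a, c2⟩)), c3⟩
    · refine ⟨?_, fun h => ?_, fun a => ?_⟩
      · rcases hN with h | h
        · exact h ▸ hS
        · exact hfinF.subset h.2
      · have : N.2 = k := hNk
        omega
      · have hsub : T ⟨N.1, hN⟩ a ∪ T₀ ×ˢ {k} ∪ {(∅, 0)} ⊆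
            (⋃ R, ⋃ a, T R a) ∪ T₀ ×ˢ {k} ∪ {(∅, 0)} :=
          Set.union_subset_union_left _ (Set.union_subset_union_left _
            (Set.subset_iUnion₂ (s := fun R a => T R a) _ _))
        obtain ⟨N₁, h1, N₂, h2, g, h3, h4⟩ := hT ⟨N.1, hN⟩ a
        exact ⟨N₁, hsub h1, N₂, hsub h2, g, h3.trans hNk.symm, h4⟩
    · obtain ⟨a1, a2, a3⟩ := isDistribution_empty (W := W) N hN
      refine ⟨a1, a2, fun b => ?_⟩
      obtain ⟨N₁, c1, N₂, c2, c3⟩ := a3 b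
      exact ⟨N₁, .inr c1, N₂, .inr c2, c3⟩
  · exact .inl (.inr ⟨Set.mem_insert _ _, rfl⟩)

/-! ### Simulation by a deterministic automaton -/

/-- The outputs of the runs on `y` that start from configurations in `R`. -/
def outputs (W : WeightedAutomaton A Q G) (R : Set (Q × G)) (y : List A) : Set G :=
  {g | ∃ x ∈ W.reach R y, (x.1, x.2⁻¹ * g) ∈ W.final}

theorem outputs_cons (R : Set (Q × G)) (a : A) (y : List A) :
    W.outputs R (a :: y) = W.outputs (W.step R a) y := rfl

theorem reach_shift (g : G) (R : Set (Q × G)) (y : List A) :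
    W.reach (shift g R) y = shift g (W.reach R y) := by
  induction y generalizing R with
  | nil => rfl
  | cons a y ih =>
    change W.reach (W.step _ a) y = shift g (W.reach (W.step R a) y)
    rw [step_shift, ih]

theorem mem_outputs_shift {g h : G} {R : Set (Q × G)} {y : List A} :
    h ∈ W.outputs (shift g R) y ↔ g⁻¹ * h ∈ W.outputs R y := by
  unfold outputs
  rw [reach_shift]
  constructor
  · rintro ⟨x, hx, hf⟩
    exact ⟨_, hx, by simpa [mul_assoc] using hf⟩
  · rintro ⟨x, hx, hf⟩
    exact ⟨(x.1, g * x.2), by simpa [mem_shift] using hx, by simpa [mul_assoc] using hf⟩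

theorem outputs_union (R R' : Set (Q × G)) (y : List A) :
    W.outputs (R ∪ R') y = W.outputs R y ∪ W.outputs R' y := by
  ext g
  simp only [outputs, mem_reach, Set.mem_union]
  constructor
  · rintro ⟨z, ⟨x, hx | hx, hp⟩, hf⟩
    · exact .inl ⟨z, ⟨x, hx, hp⟩, hf⟩
    · exact .inr ⟨z, ⟨x, hx, hp⟩, hf⟩
  · rintro (⟨z, ⟨x, hx, hp⟩, hf⟩ | ⟨z, ⟨x, hx, hp⟩, hf⟩)
    · exact ⟨z, ⟨x, .inl hx, hp⟩, hf⟩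
    · exact ⟨z, ⟨x, .inr hx, hp⟩, hf⟩

theorem mem_rel_iff {y : List A} {g : G} : (y, g) ∈ W.rel ↔ g ∈ W.outputs W.init y := by
  constructor
  · rintro ⟨p, q, α, β, γ, h1, h2, h3, h4⟩
    change g = _ at h4
    subst h4
    refine ⟨(q, α * β), mem_reach.2 ⟨_, h1, ?_⟩, ?_⟩
    · simpa [Path] using h2
    · change (q, (α * β)⁻¹ * (α * β * γ)) ∈ W.final
      rwa [inv_mul_cancel_left]
  · rintro ⟨x, hx, hf⟩
    obtain ⟨x₀, h0, hp⟩ := mem_reach.1 hx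
    exact ⟨_, _, _, _, _, h0, hp, hf, by simp⟩

variable {P : Type*} {V : WeightedAutomaton A P G}

/-- A set `T` of pairs `(R, B)` of sets of configurations links `W` and `V` if the runs of `W` from
the configurations in `R` are simulated by the runs of `V` from the configurations in `B`: the final
outputs agree, and after each letter, and up to a common shift, both sides are distributed over two
pairs in `T`. -/
def Linked (W : WeightedAutomaton A Q G) (V : WeightedAutomaton A P G)
    (T : Set (Set (Q × G) × Set (P × G))) : Prop :=
  ∀ N ∈ T, W.outputs N.1 [] = V.outputs N.2 [] ∧
    ∀ a, ∃ N₁ ∈ T, ∃ N₂ ∈ T, ∃ g, W.step N.1 a = shift g (N₁.1 ∪ N₂.1) ∧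
      V.step N.2 a = shift g (N₁.2 ∪ N₂.2)

theorem Linked.outputs_eq {T : Set (Set (Q × G) × Set (P × G))} (h : W.Linked V T)
    (y : List A) : ∀ N ∈ T, W.outputs N.1 y = V.outputs N.2 y := by
  induction y with
  | nil => exact fun N hN => (h N hN).1
  | cons a y ih =>
    intro N hN
    obtain ⟨N₁, h1, N₂, h2, g, hW, hV⟩ := (h N hN).2 a
    rw [outputs_cons, outputs_cons, hW, hV]
    ext x
    rw [mem_outputs_shift, mem_outputs_shift, outputs_union, ih N₁ h1, ih N₂ h2, outputs_union]

/-- At most one transition leaves a given state reading a given letter. -/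
def IsDeterministic (V : WeightedAutomaton A P G) : Prop :=
  ∀ (p : P) (a : A) (α β : G) (q r : P),
    (p, a, α, q) ∈ V.trans → (p, a, β, r) ∈ V.trans → α = β ∧ q = r

/-- The automaton `V` with `x` as its only initial pair. -/
def startingAt (V : WeightedAutomaton A P G) (x : P × G) : WeightedAutomaton A P G :=
  { V with init := {x}, init_finite := Set.finite_singleton _ }

theorem IsDeterministic.isSequential {M : Type*} {V : WeightedAutomaton A P M}
    (h : V.IsDeterministic) (x : P × M) :
    (V.startingAt x).IsSequential :=
  ⟨⟨x, rfl, fun _ hx => hx⟩, h⟩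

theorem union_run_iff {ι : Type*} [Finite ι] {S : ι → Type*}
    {V : ∀ i, WeightedAutomaton A (S i) G} {i : ι} {p : S i} {y : List A} {α : G}
    {t : Σ i, S i} :
    (union V).Run ⟨i, p⟩ y α t ↔ ∃ q, t = ⟨i, q⟩ ∧ (V i).Run p y α q := by
  constructor
  · intro h
    generalize hs : (⟨i, p⟩ : Σ i, S i) = s at h
    induction h generalizing p with
    | nil => exact ⟨p, hs.symm, .nil p⟩
    | cons h1 _ ih =>
      subst hs
      obtain ⟨i', ⟨p', a, α, q⟩, h2, h3⟩ := Set.mem_iUnion.1 h1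
      simp only [Prod.mk.injEq, Sigma.mk.injEq] at h3
      obtain ⟨⟨rfl, hp⟩, rfl, rfl, rfl⟩ := h3
      obtain rfl := eq_of_heq hp
      obtain ⟨r, hr, h4⟩ := ih rfl
      exact ⟨r, hr, .cons h2 h4⟩
  · rintro ⟨q, rfl, h⟩
    induction h with
    | nil => exact .nil _
    | cons h1 _ ih => exact .cons (Set.mem_iUnion.2 ⟨i, _, h1, rfl⟩) ih

theorem mem_union_rel {ι : Type*} [Finite ι] {S : ι → Type*}
    {V : ∀ i, WeightedAutomaton A (S i) G} {z : List A × G} :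
    z ∈ (union V).rel ↔ ∃ i, z ∈ (V i).rel := by
  constructor
  · rintro ⟨p, q, α, β, γ, h1, h2, h3, h4⟩
    obtain ⟨i, x, hx, he⟩ := Set.mem_iUnion.1 h1
    simp only [Prod.mk.injEq] at he
    obtain ⟨rfl, rfl⟩ := he
    obtain ⟨q, rfl, h5⟩ := union_run_iff.1 h2
    obtain ⟨i', x', hx', he⟩ := Set.mem_iUnion.1 h3
    simp only [Prod.mk.injEq, Sigma.mk.injEq] at he
    obtain ⟨⟨rfl, hq⟩, rfl⟩ := he
    obtain rfl := eq_of_heq hq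
    exact ⟨_, _, _, _, _, _, hx, h5, hx', h4⟩
  · rintro ⟨i, p, q, α, β, γ, h1, h2, h3, h4⟩
    exact ⟨⟨i, p⟩, ⟨i, q⟩, α, β, γ, Set.mem_iUnion.2 ⟨i, _, h1, rfl⟩,
      union_run_iff.2 ⟨q, rfl, h2⟩, Set.mem_iUnion.2 ⟨i, _, h3, rfl⟩, h4⟩

/-- A link turns into an equivalence with a union of automata. -/
theorem Linked.union_rel_eq {T : Set (Set (Q × G) × Set (P × G))} (h : W.Linked V T) {ι : Type*}
    [Finite ι] {ini : ι → P × G} (h0 : (W.init, Set.range ini) ∈ T) :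
    (union fun i => V.startingAt (ini i)).rel = W.rel := by
  ext ⟨y, g⟩
  rw [mem_union_rel, mem_rel_iff, h.outputs_eq y _ h0]
  simp only [mem_rel_iff]
  change (∃ i, g ∈ V.outputs {ini i} y) ↔ _
  simp only [outputs, mem_reach]
  constructor
  · rintro ⟨i, z, ⟨x, rfl, hp⟩, hf⟩
    exact ⟨z, ⟨ini i, ⟨i, rfl⟩, hp⟩, hf⟩
  · rintro ⟨z, ⟨_, ⟨i, rfl⟩, hp⟩, hf⟩
    exact ⟨i, z, ⟨ini i, rfl, hp⟩, hf⟩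

/-- A pair `(R, d)` of a distribution provides `d` states of the simulating automaton. -/
theorem IsDistribution.exists_linked [Finite A] {T : Set (Set (Q × G) × ℕ)}
    (h : W.IsDistribution T) (hT : T.Finite) {S : Set (Q × G)} {k : ℕ} (hS : (S, k) ∈ T) :
    ∃ (n : ℕ) (V : WeightedAutomaton A (Fin n) G) (ini : Fin k → Fin n × G)
      (T' : Set (Set (Q × G) × Set (Fin n × G))), V.IsDeterministic ∧ T'.Finite ∧
      (∀ N ∈ T', N.1.Finite ∧ N.2.Finite) ∧ W.Linked V T' ∧ (S, Set.range ini) ∈ T' := by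
  have : Finite T := hT
  have hstep : ∀ (N : T) (a : A), ∃ (N₁ N₂ : T) (g : G), N₁.1.2 + N₂.1.2 = N.1.2 ∧
      W.step N.1.1 a = shift g (N₁.1.1 ∪ N₂.1.1) := by
    intro N a
    obtain ⟨N₁, h1, N₂, h2, g, h3, h4⟩ := (h N.1 N.2).2.2 a
    exact ⟨⟨N₁, h1⟩, ⟨N₂, h2⟩, g, h3, h4⟩
  choose L R g hsum hst using hstep
  obtain ⟨n, ⟨e⟩⟩ := Finite.exists_equiv_fin (Σ N : T, Fin N.1.2)
  let next : (Σ N : T, Fin N.1.2) → A → (Σ N : T, Fin N.1.2) := fun p a =>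
    Sum.elim (fun j => ⟨L p.1 a, j⟩) (fun j => ⟨R p.1 a, j⟩)
      (finSumFinEquiv.symm (Fin.cast (hsum p.1 a).symm p.2))
  let V : WeightedAutomaton A (Fin n) G :=
    { init := ∅
      final := ⋃ p : (Σ N : T, Fin N.1.2), (fun γ => (e p, γ)) '' W.outputs p.1.1.1 []
      trans := Set.range fun s : (Σ N : T, Fin N.1.2) × A =>
        (e s.1, s.2, g s.1.1 s.2, e (next s.1 s.2))
      init_finite := Set.finite_empty
      final_finite := by
        refine Set.finite_iUnion fun p => Set.Finite.image _ ?_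
        refine ((h p.1.1 p.1.2).1.image2 (fun x z => x.2 * z.2) W.final_finite).subset ?_
        rintro γ ⟨x, hx, hf⟩
        exact ⟨x, hx, _, hf, by simp⟩
      trans_finite := Set.finite_range _ }
  let B : T → Set (Fin n × G) := fun N => Set.range fun j => (e ⟨N, j⟩, 1)
  refine ⟨n, V, fun j => (e ⟨⟨_, hS⟩, j⟩, 1), Set.range fun N : T => (N.1.1, B N), ?_,
    Set.finite_range _, ?_, ?_, ⟨⟨_, hS⟩, rfl⟩⟩
  · rintro p a α β q r ⟨s, hs⟩ ⟨s', hs'⟩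
    simp only [Prod.mk.injEq] at hs hs'
    obtain ⟨rfl, rfl, rfl, rfl⟩ := hs
    obtain ⟨h1, h2, rfl, rfl⟩ := hs'
    obtain rfl : s' = s := Prod.ext (e.injective h1) h2
    exact ⟨rfl, rfl⟩
  · rintro _ ⟨N, rfl⟩
    exact ⟨(h N.1 N.2).1, Set.finite_range _⟩
  · rintro _ ⟨N, rfl⟩
    refine ⟨?_, fun a => ⟨_, ⟨L N a, rfl⟩, _, ⟨R N a, rfl⟩, g N a, hst N a, ?_⟩⟩
    · ext γ
      constructor
      · intro hγ
        rcases Nat.eq_zero_or_pos N.1.2 with h0 | h0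
        · obtain ⟨x, hx, -⟩ := hγ
          have := (h N.1 N.2).2.1 h0
          change x ∈ N.1.1 at hx
          rw [this] at hx
          exact hx.elim
        · refine ⟨(e ⟨N, ⟨0, h0⟩⟩, 1), ⟨_, rfl⟩, ?_⟩
          exact Set.mem_iUnion.2 ⟨⟨N, ⟨0, h0⟩⟩, γ, hγ, by simp⟩
      · rintro ⟨_, ⟨j, rfl⟩, hf⟩
        obtain ⟨p, γ', hγ, he⟩ := Set.mem_iUnion.1 hf
        simp only [Prod.mk.injEq, inv_one, one_mul] at he
        obtain ⟨he, rfl⟩ := he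
        obtain rfl := e.injective he
        exact hγ
    · ext ⟨q, γ⟩
      constructor
      · rintro ⟨_, ⟨j, rfl⟩, ⟨s, hs⟩⟩
        simp only [Prod.mk.injEq, inv_one, one_mul] at hs
        obtain ⟨h1, rfl, rfl, rfl⟩ := hs
        have h2 := e.injective h1
        obtain ⟨p, a⟩ := s
        simp only at h2
        subst h2
        rw [mem_shift, inv_mul_cancel]
        rcases hj : finSumFinEquiv.symm (Fin.cast (hsum N a).symm j) with j' | j'
        · refine .inl ⟨j', ?_⟩
          simp [next, hj]
        · refine .inr ⟨j', ?_⟩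
          simp [next, hj]
      · intro hz
        have key : ∀ j : Fin (L N a).1.2 ⊕ Fin (R N a).1.2,
            (e (Sum.elim (fun j => ⟨L N a, j⟩) (fun j => ⟨R N a, j⟩) j), g N a) ∈
              V.step (B N) a := by
          intro j
          refine ⟨(e ⟨N, Fin.cast (hsum N a) (finSumFinEquiv j)⟩, 1), ⟨_, rfl⟩,
            (⟨N, Fin.cast (hsum N a) (finSumFinEquiv j)⟩, a), ?_⟩
          simp [next]
        rcases hz with ⟨j, hj⟩ | ⟨j, hj⟩ <;>
        · obtain ⟨rfl, hγ⟩ := Prod.mk.injEq .. ▸ hj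
          obtain rfl := inv_mul_eq_one.1 hγ.symm
          first | exact key (.inl j) | exact key (.inr j)

theorem BTP.exists_linked [Finite A] [Finite Q] {k : ℕ} (h : W.BTP k) :
    ∃ (n : ℕ) (V : WeightedAutomaton A (Fin n) G) (ini : Fin k → Fin n × G)
      (T : Set (Set (Q × G) × Set (Fin n × G))), V.IsDeterministic ∧ T.Finite ∧
      (∀ N ∈ T, N.1.Finite ∧ N.2.Finite) ∧ W.Linked V T ∧ (W.init, Set.range ini) ∈ T := by
  obtain ⟨T, hT, hd, hm⟩ := exists_isDistribution k W.init W.init_finite h.not_branch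
  exact hd.exists_linked hT hm

end WeightedAutomaton

/-! ### Computable predicates -/

theorem Computable.list_all {α β : Type*} [Primcodable α] [Primcodable β] {f : α → List β}
    (hf : Computable f) {p : α → β → Bool} (hp : Computable fun x : α × β => p x.1 x.2) :
    Computable fun a => (f a).all (p a) := by
  have hp2 : Computable₂ p := hp
  -- the conjunction over the first `n` elements, by recursion on `n`
  have h : Computable fun a => Nat.rec (motive := fun _ => Bool) true
      (fun n acc => acc && (((f a)[n]?).map (p a)).getD true)
      (f a).length := by
    refine Computable.nat_rec (Computable.list_length.comp hf) (Computable.const true)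
      (h := fun a s => s.2 && (((f a)[s.1]?).map (p a)).getD true) ?_
    have h1 : Computable fun x : α × (ℕ × Bool) => f x.1 := hf.comp Computable.fst
    have h2 : Computable fun x : α × (ℕ × Bool) => x.2.1 := Computable.fst.comp Computable.snd
    have h3 : Computable fun x : α × (ℕ × Bool) => (f x.1)[x.2.1]? :=
      Computable.list_getElem?.comp h1 h2
    have h4 : Computable₂ fun (x : α × (ℕ × Bool)) b => p x.1 b :=
      hp2.comp (Computable.fst.comp Computable.fst) Computable.snd
    have h5 : Computable fun x : α × (ℕ × Bool) => (((f x.1)[x.2.1]?).map (p x.1)).getD true :=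
      Computable.option_getD (Computable.option_map h3 h4) (Computable.const true)
    exact Primrec.and.to_comp.comp (Computable.snd.comp Computable.snd) h5
  refine h.of_eq fun a => ?_
  have key : ∀ n, Nat.rec (motive := fun _ => Bool) true
      (fun n acc => acc && (((f a)[n]?).map (p a)).getD true) n = ((f a).take n).all (p a) := by
    intro n
    induction n with
    | zero => simp
    | succ n ih =>
      simp only [ih, List.take_add_one, List.all_append]
      cases (f a)[n]? <;> simp
  rw [key, List.take_length]

namespace ComputablePred

variable {α β : Type*} [Primcodable α] [Primcodable β]

protected theorem and {p q : α → Prop} (hp : ComputablePred p) (hq : ComputablePred q) :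
    ComputablePred fun a => p a ∧ q a := by
  classical
  refine Computable.computablePred ((Primrec.and.to_comp.comp hp.decide hq.decide).of_eq ?_)
  intro a
  simp

protected theorem imp {p q : α → Prop} (hp : ComputablePred p) (hq : ComputablePred q) :
    ComputablePred fun a => p a → q a :=
  (hp.and hq.not).not.of_eq fun a => by tauto

protected theorem eq {f g : α → β} (hf : Computable f) (hg : Computable g) :
    ComputablePred fun a => f a = g a := by
  classical
  exact Computable.computablePred (Primrec.eq.decide.to_comp.comp hf hg)

protected theorem lt {f g : α → ℕ} (hf : Computable f) (hg : Computable g) :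
    ComputablePred fun a => f a < g a :=
  Computable.computablePred (Primrec.nat_lt.decide.to_comp.comp hf hg)

theorem forall_mem {f : α → List β} (hf : Computable f) {p : α → β → Prop}
    (hp : ComputablePred fun x : α × β => p x.1 x.2) :
    ComputablePred fun a => ∀ b ∈ f a, p a b := by
  classical
  exact Computable.computablePred
    ((Computable.list_all hf (p := fun a b => decide (p a b)) hp.decide).of_eq fun a => by
      rw [Bool.eq_iff_iff]
      simp)

theorem exists_mem {f : α → List β} (hf : Computable f) {p : α → β → Prop}
    (hp : ComputablePred fun x : α × β => p x.1 x.2) :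
    ComputablePred fun a => ∃ b ∈ f a, p a b :=
  (forall_mem hf (p := fun a b => ¬ p a b) hp.not).not.of_eq fun a => by simp

end ComputablePred

/-! ### Certificates -/

namespace WACode

variable {G : Type u} [Group G]

/-- The set of configurations of an automaton with `n` states that is described by a list. -/
def configs (n : ℕ) (l : List (ℕ × G)) : Set (Fin n × G) := {x | ((x.1 : ℕ), x.2) ∈ l}

/-- A list of configurations describes the initial configurations of an automaton. -/
def InitEq (c : WACode G) (l : List (ℕ × G)) : Prop :=
  (∀ x ∈ c.2.1, x.1 < c.1 → x ∈ l) ∧ ∀ x ∈ l, x ∈ c.2.1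

/-- The final outputs of `c` from the configurations in `l` are final outputs of `c'` from those in
`l'`. -/
def FinalLE (c c' : WACode G) (l l' : List (ℕ × G)) : Prop :=
  ∀ x ∈ l, ∀ f ∈ c.2.2.1, (f.1 = x.1 ∧ x.1 < c.1) →
    ∃ x' ∈ l', ∃ f' ∈ c'.2.2.1, (f'.1 = x'.1 ∧ x'.1 < c'.1) ∧ x.2 * f.2 = x'.2 * f'.2

/-- Reading the letter `a`, the automaton passes from the configurations in `l` to those in `l'`,
shifted by `g`. -/
def StepEq (c : WACode G) (l : List (ℕ × G)) (a : ℕ) (g : G) (l' : List (ℕ × G)) : Prop :=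
  (∀ x ∈ l, ∀ t ∈ c.2.2.2, (t.1 = x.1 ∧ t.2.1 = a ∧ x.1 < c.1 ∧ t.2.2.2 < c.1) →
    ∃ y ∈ l', y.1 = t.2.2.2 ∧ g * y.2 = x.2 * t.2.2.1) ∧
  ∀ y ∈ l', ∃ x ∈ l, ∃ t ∈ c.2.2.2, (t.1 = x.1 ∧ t.2.1 = a ∧ x.1 < c.1 ∧ t.2.2.2 = y.1) ∧
    g * y.2 = x.2 * t.2.2.1

/-- At most one transition leaves a given state reading a given letter. -/
def Deterministic (c : WACode G) : Prop :=
  ∀ t ∈ c.2.2.2, ∀ t' ∈ c.2.2.2, (t.1 = t'.1 ∧ t.2.1 = t'.2.1) → t.2.2 = t'.2.2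

/-- A finite piece of evidence for the equivalence of an automaton with a union of deterministic
ones: the code of the deterministic automata, which differ only in their initial pairs, and a link
together with the group elements that occur in it as shifts. -/
abbrev Certificate (G : Type u) : Type u :=
  WACode G × List (List (ℕ × G) × List (ℕ × G)) × List G

/-- The certificate `e` is correct for the automaton `c` over `m` letters and `k` deterministic
automata. -/
def Certifies (m k : ℕ) (c : WACode G) (e : Certificate G) : Prop :=
  (e.1.2.1.length = k ∧ (∀ x ∈ e.1.2.1, x.1 < e.1.1) ∧ e.1.Deterministic) ∧
  (∃ N ∈ e.2.1, c.InitEq N.1 ∧ e.1.InitEq N.2) ∧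
  ∀ N ∈ e.2.1, (FinalLE c e.1 N.1 N.2 ∧ FinalLE e.1 c N.2 N.1) ∧
    ∀ a ∈ List.range m, ∃ N₁ ∈ e.2.1, ∃ N₂ ∈ e.2.1, ∃ g ∈ e.2.2,
      c.StepEq N.1 a g (N₁.1 ++ N₂.1) ∧ e.1.StepEq N.2 a g (N₁.2 ++ N₂.2)

section Computability

attribute [local fun_prop] Computable
attribute [local fun_prop] Computable.id Computable.const Computable.comp Computable.fst
  Computable.snd Computable.pair

variable [Primcodable G] {α : Type*} [Primcodable α]

theorem computablePred_initEq {M : Type*} [Primcodable M] {c : α → WACode M}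
    {l : α → List (ℕ × M)} (hc : Computable c)
    (hl : Computable l) : ComputablePred fun a => (c a).InitEq (l a) := by
  have hmem : ∀ {β : Type _} [Primcodable β] {x : β → ℕ × M} {l : β → List (ℕ × M)},
      Computable x → Computable l → ComputablePred fun b => x b ∈ l b := by
    intro β _ x l hx hl
    refine (ComputablePred.exists_mem hl (p := fun b y => y = x b) (.eq ?_ ?_)).of_eq ?_
    · fun_prop
    · fun_prop
    · simp
  unfold InitEq
  refine .and (.forall_mem ?_ (.imp (.lt ?_ ?_) (hmem ?_ ?_))) (.forall_mem ?_ (hmem ?_ ?_)) <;>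
    fun_prop

variable (hmul : Computable₂ fun g h : G => g * h)
include hmul

theorem computablePred_finalLE {c c' : α → WACode G} {l l' : α → List (ℕ × G)}
    (hc : Computable c) (hc' : Computable c') (hl : Computable l) (hl' : Computable l') :
    ComputablePred fun a => FinalLE (c a) (c' a) (l a) (l' a) := by
  unfold FinalLE
  refine .forall_mem ?_ (.forall_mem ?_ (.imp (.and (.eq ?_ ?_) (.lt ?_ ?_))
    (.exists_mem ?_ (.exists_mem ?_ (.and (.and (.eq ?_ ?_) (.lt ?_ ?_)) (.eq
      (hmul.comp ?_ ?_) (hmul.comp ?_ ?_))))))) <;> fun_prop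

theorem computablePred_stepEq {c : α → WACode G} {l l' : α → List (ℕ × G)} {i : α → ℕ} {g : α → G}
    (hc : Computable c) (hl : Computable l) (hi : Computable i) (hg : Computable g)
    (hl' : Computable l') :
    ComputablePred fun a => (c a).StepEq (l a) (i a) (g a) (l' a) := by
  unfold StepEq
  refine .and
    (.forall_mem ?_ (.forall_mem ?_ (.imp (.and (.eq ?_ ?_) (.and (.eq ?_ ?_)
      (.and (.lt ?_ ?_) (.lt ?_ ?_)))) (.exists_mem ?_ (.and (.eq ?_ ?_)
        (.eq (hmul.comp ?_ ?_) (hmul.comp ?_ ?_)))))))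
    (.forall_mem ?_ (.exists_mem ?_ (.exists_mem ?_ (.and (.and (.eq ?_ ?_) (.and (.eq ?_ ?_)
      (.and (.lt ?_ ?_) (.eq ?_ ?_)))) (.eq (hmul.comp ?_ ?_) (hmul.comp ?_ ?_)))))) <;>
    fun_prop

theorem computablePred_certifies : ComputablePred
    fun x : (ℕ × ℕ × WACode G) × Certificate G => Certifies x.1.1 x.1.2.1 x.1.2.2 x.2 := by
  have hrange : Computable List.range := Primrec.list_range.to_comp
  have hlength : Computable (List.length : List (ℕ × G) → ℕ) := Computable.list_length
  have happ : ∀ {β : Type _} [Primcodable β] {l l' : β → List (ℕ × G)}, Computable l →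
      Computable l' → Computable fun b => l b ++ l' b :=
    fun h h' => Computable.list_append.comp h h'
  unfold Certifies Deterministic
  refine .and (.and (.eq ?_ ?_) (.and (.forall_mem ?_ (.lt ?_ ?_))
      (.forall_mem ?_ (.forall_mem ?_ (.imp (.and (.eq ?_ ?_) (.eq ?_ ?_)) (.eq ?_ ?_))))))
    (.and (.exists_mem ?_ (.and (computablePred_initEq ?_ ?_) (computablePred_initEq ?_ ?_)))
      (.forall_mem ?_ (.and (.and (computablePred_finalLE hmul ?_ ?_ ?_ ?_)
          (computablePred_finalLE hmul ?_ ?_ ?_ ?_))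
        (.forall_mem ?_ (.exists_mem ?_ (.exists_mem ?_ (.exists_mem ?_ (.and
          (computablePred_stepEq hmul ?_ ?_ ?_ ?_ (happ ?_ ?_))
          (computablePred_stepEq hmul ?_ ?_ ?_ ?_ (happ ?_ ?_))))))))))
  all_goals fun_prop

end Computability

end WACode

namespace WACode

variable {G : Type u} {m : ℕ}

open WeightedAutomaton

/-! ### Correctness and existence of certificates -/

theorem configs_append (n : ℕ) (l l' : List (ℕ × G)) :
    configs n (l ++ l') = configs n l ∪ configs n l' := by
  ext x
  simp [configs]

theorem exists_list_configs_eq {n : ℕ} {R : Set (Fin n × G)} (hR : R.Finite) :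
    ∃ l : List (ℕ × G), (∀ x ∈ l, x.1 < n) ∧ configs n l = R := by
  refine ⟨hR.toFinset.toList.map fun x => ((x.1 : ℕ), x.2), ?_, ?_⟩
  · intro x hx
    obtain ⟨z, -, rfl⟩ := List.mem_map.1 hx
    exact z.1.2
  · ext ⟨p, g⟩
    simp only [configs, Set.mem_ofPred_eq, List.mem_map, Finset.mem_toList,
      Set.Finite.mem_toFinset, Prod.mk.injEq, Prod.exists]
    constructor
    · rintro ⟨p', g', h, h1, rfl⟩
      obtain rfl := Fin.ext h1
      exact h
    · exact fun h => ⟨p, g, h, rfl, rfl⟩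

theorem InitEq.configs_eq {c : WACode G} {l : List (ℕ × G)} (h : c.InitEq l) :
    configs c.1 l = (c.toWA m).init := by
  ext x
  exact ⟨fun hx => h.2 _ hx, fun hx => h.1 _ hx x.1.2⟩

theorem initEq_of_configs_eq {c : WACode G} {l : List (ℕ × G)} (hl : ∀ x ∈ l, x.1 < c.1)
    (h : configs c.1 l = (c.toWA m).init) : c.InitEq l := by
  constructor
  · intro x hx hlt
    have : ((⟨x.1, hlt⟩ : Fin c.1), x.2) ∈ configs c.1 l := by
      rw [h]
      exact hx
    exact this
  · intro x hx
    have : ((⟨x.1, hl x hx⟩ : Fin c.1), x.2) ∈ (c.toWA m).init := by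
      rw [← h]
      exact hx
    exact this

theorem Deterministic.isDeterministic {c : WACode G} (h : c.Deterministic) :
    (c.toWA m).IsDeterministic := by
  intro p a α β q r h1 h2
  have := h _ h1 _ h2 ⟨rfl, rfl⟩
  simp only [Prod.mk.injEq] at this
  exact ⟨this.1, Fin.ext this.2⟩

/-- The deterministic automata described by a certificate: one for each initial pair. -/
def parts (c : WACode G) : List (WACode G) := c.2.1.map fun x => (c.1, [x], c.2.2)

theorem toWA_part {c : WACode G} {x : ℕ × G} (hx : x.1 < c.1) :
    toWA m ((c.1, [x], c.2.2) : WACode G) = (c.toWA m).startingAt (⟨x.1, hx⟩, x.2) := by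
  have : {y : Fin c.1 × G | ((y.1 : ℕ), y.2) ∈ [x]} = {(⟨x.1, hx⟩, x.2)} := by
    ext y
    simp [Prod.ext_iff, Fin.ext_iff]
  simp only [toWA, startingAt, this]

variable [Group G]

theorem finalLE_iff {c c' : WACode G} {l l' : List (ℕ × G)} :
    FinalLE c c' l l' ↔ (c.toWA m).outputs (configs c.1 l) [] ⊆
      (c'.toWA m).outputs (configs c'.1 l') [] := by
  constructor
  · rintro h g ⟨x, hx, hf⟩
    obtain ⟨⟨q, b⟩, hx', ⟨p, b'⟩, hf', ⟨e, hr⟩, he⟩ := h _ hx _ hf ⟨rfl, x.1.2⟩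
    simp only at e hr he
    subst e
    rw [mul_inv_cancel_left] at he
    refine ⟨(⟨p, hr⟩, b), hx', ?_⟩
    subst he
    rw [inv_mul_cancel_left]
    exact hf'
  · rintro h ⟨q, b⟩ hx ⟨q', γ⟩ hf ⟨e, hr⟩
    simp only at e hr
    subst e
    have : b * γ ∈ (c.toWA m).outputs (configs c.1 l) [] :=
      ⟨(⟨q', hr⟩, b), hx, by rw [inv_mul_cancel_left]; exact hf⟩
    obtain ⟨x', hx', hf'⟩ := h this
    exact ⟨_, hx', _, hf', ⟨rfl, x'.1.2⟩, by simp⟩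

theorem StepEq.step_eq {c : WACode G} {l l' : List (ℕ × G)} {a : Fin m} {g : G}
    (h : c.StepEq l a g l') :
    (c.toWA m).step (configs c.1 l) a = shift g (configs c.1 l') := by
  ext ⟨q, b⟩
  constructor
  · rintro ⟨x, hx, ht⟩
    obtain ⟨⟨p, b'⟩, hy, e, he⟩ := h.1 _ hx _ ht ⟨rfl, rfl, x.1.2, q.2⟩
    simp only [mul_inv_cancel_left] at e he
    subst e he
    simpa [mem_shift, configs] using hy
  · intro hz
    obtain ⟨⟨p, b'⟩, hx, ⟨t1, t2, t3, t4⟩, ht, ⟨e1, e2, hr, e3⟩, he⟩ := h.2 _ hz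
    simp only [mul_inv_cancel_left] at e1 e2 e3 hr he
    subst e1 e2 e3 he
    refine ⟨(⟨t1, hr⟩, b'), hx, ?_⟩
    simpa [toWA] using ht

theorem stepEq_of_step_eq {c : WACode G} {l l' : List (ℕ × G)} {a : Fin m} {g : G}
    (hl' : ∀ x ∈ l', x.1 < c.1)
    (h : (c.toWA m).step (configs c.1 l) a = shift g (configs c.1 l')) :
    c.StepEq l a g l' := by
  constructor
  · rintro ⟨p, b⟩ hx ⟨t1, t2, t3, t4⟩ ht ⟨e1, e2, h1, h2⟩
    simp only at e1 e2 h1 h2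
    subst e1 e2
    have : ((⟨t4, h2⟩ : Fin c.1), b * t3) ∈ (c.toWA m).step (configs c.1 l) a :=
      ⟨(⟨t1, h1⟩, b), hx, by simpa [toWA] using ht⟩
    rw [h] at this
    exact ⟨_, this, rfl, by simp⟩
  · rintro ⟨q, b⟩ hy
    have : ((⟨q, hl' _ hy⟩ : Fin c.1), g * b) ∈ (c.toWA m).step (configs c.1 l) a := by
      rw [h]
      simpa [mem_shift, configs] using hy
    obtain ⟨x, hx, ht⟩ := this
    exact ⟨_, hx, _, ht, ⟨rfl, rfl, x.1.2, rfl⟩, by simp⟩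

theorem Certifies.isSequential {k : ℕ} {c : WACode G} {e : Certificate G}
    (h : Certifies m k c e) : ∀ c' ∈ e.1.parts, (c'.toWA m).IsSequential := by
  intro c' hc'
  obtain ⟨x, hx, rfl⟩ := List.mem_map.1 hc'
  rw [toWA_part (h.1.2.1 x hx)]
  exact h.1.2.2.isDeterministic.isSequential _

theorem Certifies.linked {k : ℕ} {c : WACode G} {e : Certificate G} (h : Certifies m k c e) :
    (c.toWA m).Linked (e.1.toWA m)
      {N | ∃ M ∈ e.2.1, N = (configs c.1 M.1, configs e.1.1 M.2)} := by
  rintro _ ⟨N, hN, rfl⟩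
  obtain ⟨⟨h1, h2⟩, h3⟩ := h.2.2 N hN
  refine ⟨(finalLE_iff.1 h1).antisymm (finalLE_iff.1 h2), fun a => ?_⟩
  obtain ⟨N₁, hN₁, N₂, hN₂, g, -, hs, hs'⟩ := h3 a (List.mem_range.2 a.2)
  refine ⟨_, ⟨N₁, hN₁, rfl⟩, _, ⟨N₂, hN₂, rfl⟩, g, ?_, ?_⟩
  · rw [hs.step_eq, configs_append]
  · rw [hs'.step_eq, configs_append]

theorem Certifies.union_rel_eq {k : ℕ} {c : WACode G} {e : Certificate G}
    (h : Certifies m k c e) :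
    (union fun i : Fin e.1.parts.length => (e.1.parts.get i).toWA m).rel = (c.toWA m).rel := by
  obtain ⟨N, hN, hc, he⟩ := h.2.1
  have hfin : Finite (e.1.toWA m).init := (e.1.toWA m).init_finite
  have h0 := h.linked.union_rel_eq (ι := (e.1.toWA m).init) (ini := Subtype.val)
    ⟨N, hN, by rw [Subtype.range_coe, hc.configs_eq (m := m), he.configs_eq (m := m)]⟩
  rw [← h0]
  ext z
  rw [mem_union_rel, mem_union_rel]
  constructor
  · rintro ⟨i, hi⟩
    obtain ⟨x, hx, hxe⟩ := List.mem_map.1 (List.get_mem e.1.parts i)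
    rw [← hxe, toWA_part (h.1.2.1 x hx)] at hi
    exact ⟨⟨(⟨x.1, h.1.2.1 x hx⟩, x.2), hx⟩, hi⟩
  · rintro ⟨⟨⟨p, γ⟩, hx⟩, hz⟩
    have hx' : ((p : ℕ), γ) ∈ e.1.2.1 := hx
    obtain ⟨i, hi⟩ := List.mem_iff_get.1 (List.mem_map_of_mem (f := fun x =>
      ((e.1.1, [x], e.1.2.2) : WACode G)) hx')
    refine ⟨i, ?_⟩
    have hi' : e.1.parts.get i = (e.1.1, [((p : ℕ), γ)], e.1.2.2) := hi
    rw [hi', toWA_part (x := ((p : ℕ), γ)) p.2]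
    exact hz

theorem exists_certificate {k : ℕ} {c : WACode G} (h : (c.toWA m).BTP k) :
    ∃ e, Certifies m k c e := by
  obtain ⟨n, V, ini, T, hdet, hT, hfin, hlink, hroot⟩ := h.exists_linked
  have : Finite T := hT
  have : Fintype T := Fintype.ofFinite T
  -- a code of `V`
  obtain ⟨fl, -, hfl⟩ := exists_list_configs_eq V.final_finite
  let tr : List (ℕ × ℕ × G × ℕ) := V.trans_finite.toFinset.toList.map fun t =>
    ((t.1 : ℕ), (t.2.1 : ℕ), t.2.2.1, (t.2.2.2 : ℕ))
  have htr : ∀ t, t ∈ tr ↔ ∃ s ∈ V.trans,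
      ((s.1 : ℕ), (s.2.1 : ℕ), s.2.2.1, (s.2.2.2 : ℕ)) = t := fun t => by simp [tr]
  let c' : WACode G := (n, List.ofFn fun i => (((ini i).1 : ℕ), (ini i).2), fl, tr)
  have hfinal : (c'.toWA m).final = V.final := hfl
  have htrans : (c'.toWA m).trans = V.trans := by
    ext ⟨p, a, α, q⟩
    refine (htr _).trans ⟨?_, fun h => ⟨_, h, rfl⟩⟩
    rintro ⟨⟨p', a', α', q'⟩, hs, he⟩
    simp only [Prod.mk.injEq] at he
    obtain ⟨h1, h2, rfl, h3⟩ := he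
    obtain rfl := Fin.ext h1
    obtain rfl := Fin.ext h2
    obtain rfl := Fin.ext h3
    exact hs
  have hinit : (c'.toWA m).init = Set.range ini := by
    ext ⟨p, γ⟩
    change ((p : ℕ), γ) ∈ List.ofFn _ ↔ _
    simp [Prod.ext_iff, Fin.ext_iff]
  have hstep : (c'.toWA m).step = V.step := by
    ext R a z
    unfold step
    rw [htrans]
  have hout : ∀ R, (c'.toWA m).outputs R [] = V.outputs R [] := by
    intro R
    unfold outputs
    rw [hfinal]
    rfl
  -- lists for the sets of configurations in the link, and for the shifts
  choose L hLr hL using fun N : T => exists_list_configs_eq (hfin N N.2).1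
  choose L' hLr' hL' using fun N : T => exists_list_configs_eq (hfin N N.2).2
  choose N₁ hN₁ N₂ hN₂ g hg hg' using fun N : T => (hlink N N.2).2
  let nodes : List (List (ℕ × G) × List (ℕ × G)) :=
    (Finset.univ : Finset T).toList.map fun N => (L N, L' N)
  have hmem : ∀ N : T, (L N, L' N) ∈ nodes := fun N =>
    List.mem_map_of_mem (f := fun N => (L N, L' N)) (Finset.mem_toList.2 (Finset.mem_univ N))
  let gs : List G := (Finset.univ : Finset (T × Fin m)).toList.map fun s => g s.1 s.2
  have hgs : ∀ N a, g N a ∈ gs := fun N a =>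
    List.mem_map_of_mem (f := fun s : T × Fin m => g s.1 s.2)
      (Finset.mem_toList.2 (Finset.mem_univ (N, a)))
  refine ⟨(c', nodes, gs), ⟨?_, ?_, ?_⟩, ⟨_, hmem ⟨_, hroot⟩, ?_, ?_⟩, ?_⟩
  · exact List.length_ofFn
  · intro x hx
    obtain ⟨i, rfl⟩ := List.mem_ofFn.1 hx
    exact (ini i).1.2
  · intro t ht t' ht' he
    obtain ⟨⟨p, a, α, q⟩, hs, rfl⟩ := (htr t).1 ht
    obtain ⟨⟨p', a', α', q'⟩, hs', rfl⟩ := (htr t').1 ht'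
    obtain ⟨h1, h2⟩ := he
    obtain rfl := Fin.ext h1
    obtain rfl := Fin.ext h2
    obtain ⟨rfl, rfl⟩ := hdet _ _ _ _ _ _ hs hs'
    rfl
  · exact initEq_of_configs_eq (m := m) (hLr _) (hL _)
  · exact initEq_of_configs_eq (m := m) (hLr' _) ((hL' _).trans hinit.symm)
  · intro M hM
    obtain ⟨N, -, rfl⟩ := List.mem_map.1 hM
    have heq : (c.toWA m).outputs (configs c.1 (L N)) [] =
        (c'.toWA m).outputs (configs c'.1 (L' N)) [] := by
      have : configs c'.1 (L' N) = _ := hL' N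
      rw [hL, this, hout]
      exact (hlink N N.2).1
    refine ⟨⟨finalLE_iff.2 heq.le, finalLE_iff.2 heq.ge⟩, fun a ha => ?_⟩
    lift a to Fin m using List.mem_range.1 ha
    refine ⟨_, hmem ⟨_, hN₁ N a⟩, _, hmem ⟨_, hN₂ N a⟩, g N a, hgs N a,
      stepEq_of_step_eq ?_ ?_, stepEq_of_step_eq ?_ ?_⟩
    · intro x hx
      rcases List.mem_append.1 hx with hx | hx
      exacts [hLr _ x hx, hLr _ x hx]
    · rw [configs_append, hL, hL, hL]
      exact hg N a
    · intro x hx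
      rcases List.mem_append.1 hx with hx | hx
      exacts [hLr' _ x hx, hLr' _ x hx]
    · have : ∀ N, configs c'.1 (L' N) = _ := hL'
      rw [configs_append, this, this, this, hstep]
      exact hg' N a

/-- The algorithm searches for a correct certificate. -/
theorem exists_partrec_build [Primcodable G] (hmul : Computable₂ fun g h : G => g * h) :
    ∃ build : ℕ × ℕ × WACode G →. List (WACode G), Partrec build ∧
      ∀ (m k : ℕ) (c : WACode G), (c.toWA m).BTP k →
        ∃ e : Certificate G, Certifies m k c e ∧ e.1.parts ∈ build (m, k, c) := by
  classical
  have hcert := (computablePred_certifies hmul).decide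
  have hparts : Computable (parts : WACode G → List (WACode G)) := by
    refine Primrec.to_comp (Primrec.list_map (Primrec.fst.comp Primrec.snd) ?_)
    exact (Primrec.fst.comp Primrec.fst).pair
      ((Primrec.list_cons.comp Primrec.snd (Primrec.const [])).pair
        (Primrec.snd.comp (Primrec.snd.comp Primrec.fst)))
  let test : (ℕ × ℕ × WACode G) → Certificate G → Option (List (WACode G)) := fun x e =>
    bif decide (Certifies x.1 x.2.1 x.2.2 e) then some e.1.parts else none
  have htest : Computable₂ test :=
    Computable.cond hcert
      (Computable.option_some.comp (hparts.comp (Computable.fst.comp Computable.snd)))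
      (Computable.const none)
  let find : (ℕ × ℕ × WACode G) → ℕ → Option (List (WACode G)) := fun x i =>
    (Encodable.decode (α := Certificate G) i).bind (test x)
  have hfind : Computable₂ find := Computable.bind_decode_iff.2 htest
  refine ⟨fun x => Nat.rfindOpt (find x), Partrec.rfindOpt hfind, fun m k c h => ?_⟩
  obtain ⟨e, he⟩ := exists_certificate h
  have hdom : (Nat.rfindOpt (find (m, k, c))).Dom := by
    refine Nat.rfindOpt_dom.2 ⟨Encodable.encode e, e.1.parts, ?_⟩
    change (Encodable.decode (Encodable.encode e)).bind (test (m, k, c)) = some _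
    rw [Encodable.encodek]
    simp [test, he]
  obtain ⟨i, hi⟩ := Nat.rfindOpt_spec (Part.get_mem hdom)
  simp only [find, test, Option.mem_def, Option.bind_eq_some_iff] at hi
  obtain ⟨e', -, he'⟩ := hi
  by_cases hc : Certifies m k c e'
  · simp only [hc, decide_true, cond_true, Option.some.injEq] at he'
    exact ⟨e', hc, he' ▸ Part.get_mem hdom⟩
  · simp [hc] at he'

end WACode

theorem mainTheorem2 {G : Type u} [Group G] [Group.FG G] (hG : IsInfinitary G) :
    -- existence, for every weighted automaton over `G`
    (∀ (A : Type v) [Finite A] (Q : Type w) [Finite Q] (W : WeightedAutomaton A Q G) (k : ℕ),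
      W.BTP k →
        ∃ (n : Fin k → ℕ) (V : ∀ i, WeightedAutomaton A (Fin (n i)) G),
          (∀ i, (V i).IsSequential) ∧ (WeightedAutomaton.union V).rel = W.rel) ∧
    -- effectiveness: one algorithm that works for all alphabets, all `k` and all automata over `G`,
    -- for every coding of `G` by natural numbers for which the product is computable
    (∀ _ : Primcodable G, Computable₂ (fun α β : G => α * β) →
      ∃ build : ℕ × ℕ × WACode G →. List (WACode G), Partrec build ∧
        ∀ (m k : ℕ) (c : WACode G), (c.toWA m).BTP k →
          ∃ L ∈ build (m, k, c), L.length = k ∧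
            (∀ i : Fin L.length, ((L.get i).toWA m).IsSequential) ∧
            (WeightedAutomaton.union fun i : Fin L.length => (L.get i).toWA m).rel =
              (c.toWA m).rel) := by
  refine ⟨fun A _ Q _ W k h => ?_, fun _ hmul => ?_⟩
  · obtain ⟨n, V, ini, T, hdet, -, -, hlink, hroot⟩ := h.exists_linked
    exact ⟨fun _ => n, fun i => V.startingAt (ini i), fun i => hdet.isSequential _,
      hlink.union_rel_eq hroot⟩
  · obtain ⟨build, hbuild, h⟩ := WACode.exists_partrec_build hmul
    refine ⟨build, hbuild, fun m k c hc => ?_⟩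
    obtain ⟨e, he, hmem⟩ := h m k c hc
    exact ⟨_, hmem, (List.length_map _).trans he.1.1,
      fun i => he.isSequential _ (List.get_mem _ i), he.union_rel_eq⟩
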